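/- Let $\Sigma$ be a countable signature whose symbols are numbered by natural numbers, and let $\mathcal{M}$ be a countable $\omega$-categorical $\Sigma$-structure with domain $M$ (i.e. any two countably infinite models of the complete theory of $\mathcal{M}$ are isomorphic; finite $\mathcal{M}$ is allowed). Let $\mathcal{L}(\mathcal{M})$ be the set of first-order $\Sigma$-formulas. Let $\mathcal{L}_{\mathrm{PFP}}(\mathcal{M})$ be the set of formulas obtained by closing the atomic $\Sigma$-formulas and the atoms $R(t_1,\dots,t_k)$, with $R$ a $k$-ary relation variable ($k\ge 0$), under the Boolean connectives, first-order quantification and the following rule: if $\phi$ is a formula, $R$ a $k$-ary relation variable, $X$ a tuple of $k$ distinct element variables and $Y$ a $k$-tuple of variables (or terms), then $(\mathrm{pfp}_{R,X}\,\phi)(Y)$ is a formula. This operator binds $R$ and $X$ in $\phi$. The formula $\phi$ may contain further free element variables (parameters) and relation variables bound by enclosing operators, and may itself contain $\mathrm{pfp}$ operators. Formulas of $\mathcal{L}_{\mathrm{PFP}}(\mathcal{M})$ considered below have no free relation variables. Semantics of $\mathrm{pfp}$: for a fixed interpretation of the other free variables put $R^0=\emptyset$ and $R^{j+1}=\{\bar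 a\in M^k : \mathcal{M}\models\phi(R^j,\bar a)\}$ for $j\in\mathbb{N}$. Then $(\mathrm{pfp}_{R,X}\,\phi)(Y)$ holds iff there is some $j$ with $R^{j+1}=R^j$ and the value of $Y$ lies in this $R^j$ (so it is false if the sequence never becomes stationary). Theorem. There is a map $T$ that sends every formula $\varphi(x_0,\dots,x_{n-1})$ of $\mathcal{L}_{\mathrm{PFP}}(\mathcal{M})$ to a first-order formula $T(\varphi)(x_0,\dots,x_{n-1})$ of $\mathcal{L}(\mathcal{M})$ that is equivalent to it over $\mathcal{M}$: \[ \mathcal{M}\models\varphi(\bar a)\iff\mathcal{M}\models T(\varphi)(\bar a)\qquad\text{for all }n\in\mathbb{N}\text{ and }\bar a\in M^n . \] Moreover, if the complete theory of $\mathcal{M}$ is decidable, i.e. if the set of Gödel numbers of the first-order sentences true in $\mathcal{M}$ is computable (which is the case whenever the complete types of tuples of $\mathcal{M}$ are computable), then $T$ can be chosen to be effective: there is an algorithm that, given $n$ and the Gödel number of $\varphi(x_0,\dots,x_{n-1})$, halts and outputs the Gödel number of $T(\varphi)$. -/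

import Mathlib

universe u v w

namespace PFP

open FirstOrder Language

/-- Formulas of first-order logic with partial fixed-point operators over the signature `L`.
`Γ` lists the arities of the relation variables in scope, and the element variables in scope are
`x₀, …, xₙ₋₁` (as in `L.BoundedFormula Empty n`, a quantifier binds the new variable `xₙ`).
`pfp k φ ts` is `(pfp_{R,X} φ)(ts)`: it binds a new `k`-ary relation variable `R`, which becomes
entry `0` of the list, and the `k` variables `X = (xₙ, …, xₙ₊ₖ₋₁)`. All other variables of `φ`
remain free and act as parameters. -/
inductive PFPFormula (L : FirstOrder.Language.{u, v}) : List ℕ → ℕ → Type (max u v)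
  | falsum {Γ : List ℕ} {n : ℕ} : PFPFormula L Γ n
  | equal {Γ : List ℕ} {n : ℕ} (t₁ t₂ : L.Term (Empty ⊕ Fin n)) : PFPFormula L Γ n
  | rel {Γ : List ℕ} {n l : ℕ} (R : L.Relations l) (ts : Fin l → L.Term (Empty ⊕ Fin n)) :
      PFPFormula L Γ n
  | relVar {Γ : List ℕ} {n : ℕ} (i : Fin Γ.length)
      (ts : Fin (Γ.get i) → L.Term (Empty ⊕ Fin n)) : PFPFormula L Γ n
  | imp {Γ : List ℕ} {n : ℕ} (φ ψ : PFPFormula L Γ n) : PFPFormula L Γ n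
  | all {Γ : List ℕ} {n : ℕ} (φ : PFPFormula L Γ (n + 1)) : PFPFormula L Γ n
  | pfp {Γ : List ℕ} {n : ℕ} (k : ℕ) (φ : PFPFormula L (k :: Γ) (n + k))
      (ts : Fin k → L.Term (Empty ⊕ Fin n)) : PFPFormula L Γ n

/-- The partial fixed point of an operator `F` on sets: with `S⁰ = ∅` and `Sʲ⁺¹ = F Sʲ`, it is the
set `Sʲ` for any `j` with `Sʲ⁺¹ = Sʲ`, and it is empty if there is no such `j`. -/
def partialFixedPoint {A : Type*} (F : Set A → Set A) : Set A :=
  {a | ∃ j : ℕ, F^[j + 1] ∅ = F^[j] ∅ ∧ a ∈ F^[j] ∅}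

/-- An interpretation in `M` of the relation variables whose arities are listed by `Γ`. -/
abbrev RelEnv (M : Type w) (Γ : List ℕ) : Type w :=
  (i : Fin Γ.length) → Set (Fin (Γ.get i) → M)

/-- Extend an interpretation by a value for a new relation variable, at entry `0`. -/
def RelEnv.cons {M : Type w} {Γ : List ℕ} {k : ℕ} (S : Set (Fin k → M)) (ρ : RelEnv M Γ) :
    RelEnv M (k :: Γ) :=
  fun i => Fin.cases (motive := fun i => Set (Fin ((k :: Γ).get i) → M)) S ρ i

/-- The interpretation of no relation variables. -/
def RelEnv.nil {M : Type w} : RelEnv M [] := fun i => i.elim0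

/-- Satisfaction in `M`. -/
def PFPFormula.Realize {L : FirstOrder.Language.{u, v}} {M : Type w} [L.Structure M] :
    {Γ : List ℕ} → {n : ℕ} → PFPFormula L Γ n → RelEnv M Γ → (Fin n → M) → Prop
  | _, _, .falsum, _, _ => False
  | _, _, .equal t₁ t₂, _, xs =>
      t₁.realize (Sum.elim Empty.elim xs) = t₂.realize (Sum.elim Empty.elim xs)
  | _, _, .rel R ts, _, xs =>
      Structure.RelMap R fun i => (ts i).realize (Sum.elim Empty.elim xs)
  | _, _, .relVar i ts, ρ, xs => (fun j => (ts j).realize (Sum.elim Empty.elim xs)) ∈ ρ i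
  | _, _, .imp φ ψ, ρ, xs => φ.Realize ρ xs → ψ.Realize ρ xs
  | _, _, .all φ, ρ, xs => ∀ a : M, φ.Realize ρ (Fin.snoc xs a)
  | _, _, .pfp _ φ ts, ρ, xs =>
      (fun j => (ts j).realize (Sum.elim Empty.elim xs)) ∈
        partialFixedPoint fun S => {ys | φ.Realize (RelEnv.cons S ρ) (Fin.append xs ys)}

section Codes

variable {L : FirstOrder.Language.{u, v}}

/-- Gödel numbers of terms, relative to a numbering of the function symbols. -/
def termCode [Encodable (Σ l, L.Functions l)] {n : ℕ} : L.Term (Empty ⊕ Fin n) → ℕ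
  | .var x => Nat.pair 0 (Sum.elim Empty.elim (fun i : Fin n => (i : ℕ)) x)
  | .func (l := l) f ts =>
      Nat.pair 1 (Nat.pair (Encodable.encode (⟨l, f⟩ : Σ l, L.Functions l))
        (Encodable.encode (List.ofFn fun i => termCode (ts i))))

/-- Gödel numbers of tuples of terms. -/
def termsCode [Encodable (Σ l, L.Functions l)] {n l : ℕ}
    (ts : Fin l → L.Term (Empty ⊕ Fin n)) : ℕ :=
  Encodable.encode (List.ofFn fun i => termCode (ts i))

/-- Gödel numbers of first-order formulas, relative to a numbering of the symbols of `L`. -/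
def foCode [Encodable (Σ l, L.Functions l)] [Encodable (Σ l, L.Relations l)] :
    {n : ℕ} → L.BoundedFormula Empty n → ℕ
  | _, .falsum => Nat.pair 0 0
  | _, .equal t₁ t₂ => Nat.pair 1 (Nat.pair (termCode t₁) (termCode t₂))
  | _, .rel (l := l) R ts =>
      Nat.pair 2 (Nat.pair (Encodable.encode (⟨l, R⟩ : Σ l, L.Relations l)) (termsCode ts))
  | _, .imp φ ψ => Nat.pair 3 (Nat.pair (foCode φ) (foCode ψ))
  | _, .all φ => Nat.pair 4 (foCode φ)

/-- Gödel numbers of formulas with partial fixed-point operators. -/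
def pfpCode [Encodable (Σ l, L.Functions l)] [Encodable (Σ l, L.Relations l)] :
    {Γ : List ℕ} → {n : ℕ} → PFPFormula L Γ n → ℕ
  | _, _, .falsum => Nat.pair 0 0
  | _, _, .equal t₁ t₂ => Nat.pair 1 (Nat.pair (termCode t₁) (termCode t₂))
  | _, _, .rel (l := l) R ts =>
      Nat.pair 2 (Nat.pair (Encodable.encode (⟨l, R⟩ : Σ l, L.Relations l)) (termsCode ts))
  | _, _, .imp φ ψ => Nat.pair 3 (Nat.pair (pfpCode φ) (pfpCode ψ))
  | _, _, .all φ => Nat.pair 4 (pfpCode φ)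
  | _, _, .relVar i ts => Nat.pair 5 (Nat.pair i (termsCode ts))
  | _, _, .pfp k φ ts => Nat.pair 6 (Nat.pair k (Nat.pair (pfpCode φ) (termsCode ts)))

end Codes

/-- `M` is ω-categorical: any two countably infinite models of its complete theory are
isomorphic. -/
def OmegaCategorical (L : FirstOrder.Language.{u, v}) (M : Type w) [L.Structure M] : Prop :=
  Cardinal.aleph0.{w}.Categorical (L.completeTheory M)

/-- The complete theory of `M` (that is, the complete type of the empty tuple) is decidable: the
set of Gödel numbers of the sentences true in `M` is computable. -/
def HasDecidableTheory (L : FirstOrder.Language.{u, v}) [Encodable (Σ l, L.Functions l)]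
    [Encodable (Σ l, L.Relations l)] (M : Type w) [L.Structure M] : Prop :=
  ComputablePred fun m : ℕ => ∃ σ : L.Sentence, M ⊨ σ ∧ foCode σ = m

end PFP

/-!
A countable ω-categorical structure `M` realizes only finitely many types of `n`-tuples, for each
`n` (`OmegaCategorical.finite_types`, the Ryll-Nardzewski theorem). Hence an operator on `k`-ary
relations that respects types takes its stages in a finite set, and their sequence is ultimately
periodic: if `p` is divisible by `d!`, where `d` bounds the number of these relations, then the
stages `p` and `2 * p` coincide, and the partial fixed point is stage `p` if this stage is
stationary and empty otherwise.

Every stage is first-order definable from the operator. So `translation p` turns a formula with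
fixed-point operators, from the inside out, into a first-order formula, together with a second
first-order formula which says that the stages `p` and `2 * p` coincide wherever an operator is
evaluated. The second formula implies that the translation is correct (`realize_translation`), and
it holds for all sufficiently divisible `p` (`exists_forall_realize_translation_snd`), because
satisfaction of formulas with fixed-point operators depends only on types
(`PFPFormula.realize_congr`). The map `T` uses the least period for which the second formula holds.

On Gödel numbers the translation is primitive recursive, uniformly in the period
(`exists_primrec_translation`). The only unbounded search is the one for the period. It asks the
theory of `M` for the truth of a single sentence at each step, so it is effective if the theory is
decidable.

For the Ryll-Nardzewski theorem, in the infinite case, `M` realizes every set of formulas that is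
finitely satisfiable in it, because it is isomorphic to every countable model of its theory. This
makes the isolated types dense, and lets one build an atomic elementary substructure inside `M`. It
is isomorphic to `M`, so all types are isolated, and finitely many isolating formulas cover `M`.
-/

namespace PFP

open FirstOrder Language

/-! ### Types of tuples -/

section SameType

variable {L : FirstOrder.Language.{u, v}} {M : Type w} [L.Structure M]

/-- Two tuples have the same complete type over the empty set. -/
def SameType (L : FirstOrder.Language.{u, v}) {M : Type w} [L.Structure M] {n : ℕ}
    (xs ys : Fin n → M) : Prop :=
  ∀ φ : L.BoundedFormula Empty n, φ.Realize Empty.elim xs ↔ φ.Realize Empty.elim ys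

theorem SameType.refl {n : ℕ} (xs : Fin n → M) : SameType L xs xs := fun _ => Iff.rfl

theorem SameType.symm {n : ℕ} {xs ys : Fin n → M} (h : SameType L xs ys) : SameType L ys xs :=
  fun φ => (h φ).symm

theorem SameType.trans {n : ℕ} {xs ys zs : Fin n → M} (h : SameType L xs ys)
    (h' : SameType L ys zs) : SameType L xs zs :=
  fun φ => (h φ).trans (h' φ)

/-- Equality of types. The elements of the quotient are the types that `n`-tuples of `M` realize. -/
def typeSetoid (L : FirstOrder.Language.{u, v}) (M : Type w) [L.Structure M] (n : ℕ) :
    Setoid (Fin n → M) where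
  r := SameType L
  iseqv := ⟨SameType.refl, SameType.symm, SameType.trans⟩

/-- Terms can be substituted for the variables of a formula. As no particular formula is needed, it
is taken from Mathlib's substitution in formulas with named variables. -/
theorem exists_substitution {m n : ℕ} (φ : L.BoundedFormula Empty m)
    (σ : Fin m → L.Term (Empty ⊕ Fin n)) :
    ∃ ψ : L.BoundedFormula Empty n, ∀ (xs : Fin n → M), ψ.Realize Empty.elim xs ↔
      φ.Realize Empty.elim (fun i => (σ i).realize (Sum.elim Empty.elim xs)) := by
  let ψ : L.Formula (Fin n) := φ.toFormula.subst
    (Sum.elim Empty.elim fun i => (σ i).relabel (Sum.elim Empty.elim id))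
  refine ⟨BoundedFormula.relabel Sum.inr ψ, fun xs => ?_⟩
  rw [Formula.realize_relabel_sumInr]
  refine BoundedFormula.realize_subst.trans ((BoundedFormula.realize_toFormula _ _).trans ?_)
  refine iff_of_eq ?_
  congr 1
  · exact Subsingleton.elim _ _
  · funext i
    simp only [Function.comp_apply, Sum.elim_inr, Term.realize_relabel]
    congr 1
    funext j
    rcases j with j | j
    · exact j.elim
    · rfl

/-- Tuples of the same type stay so under the same term substitution. -/
theorem SameType.substitute {m n : ℕ} {xs ys : Fin n → M} (h : SameType L xs ys)
    (σ : Fin m → L.Term (Empty ⊕ Fin n)) :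
    SameType L (fun i => (σ i).realize (Sum.elim Empty.elim xs))
      (fun i => (σ i).realize (Sum.elim Empty.elim ys)) := by
  intro φ
  obtain ⟨ψ, hψ⟩ := exists_substitution (M := M) φ σ
  rw [← hψ, ← hψ, h]

theorem SameType.comp {m n : ℕ} {xs ys : Fin n → M} (h : SameType L xs ys)
    (g : Fin m → Fin n) : SameType L (xs ∘ g) (ys ∘ g) := by
  simpa [Function.comp_def] using h.substitute fun i => Term.var (Sum.inr (g i))

/-- If `M` realizes only finitely many types of `n + 1`-tuples, then these types form a
back-and-forth system: a separating formula for each of the other types can be put into one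
existential formula. -/
theorem SameType.exists_snoc {n : ℕ} [hf : Finite (Quotient (typeSetoid L M (n + 1)))]
    {xs ys : Fin n → M} (h : SameType L xs ys) (a : M) :
    ∃ b : M, SameType L (Fin.snoc xs a : Fin (n + 1) → M) (Fin.snoc ys b) := by
  classical
  by_contra! hne
  have key : ∀ q : Quotient (typeSetoid L M (n + 1)), ∃ χ : L.BoundedFormula Empty (n + 1),
      χ.Realize Empty.elim (Fin.snoc xs a : Fin (n + 1) → M) ∧
      (¬ SameType L (Fin.snoc xs a : Fin (n + 1) → M) q.out → ¬ χ.Realize Empty.elim q.out) := by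
    intro q
    by_cases hq : SameType L (Fin.snoc xs a : Fin (n + 1) → M) q.out
    · exact ⟨⊤, by simp, fun h => absurd hq h⟩
    · obtain ⟨χ, hχ⟩ := not_forall.1 hq
      by_cases h1 : χ.Realize Empty.elim (Fin.snoc xs a : Fin (n + 1) → M)
      · exact ⟨χ, h1, fun _ h2 => hχ (by tauto)⟩
      · refine ⟨χ.not, by simpa using h1, fun _ h2 => hχ ?_⟩
        rw [BoundedFormula.realize_not] at h2
        tauto
  choose χ hχ1 hχ2 using key
  have h1 : (BoundedFormula.iInf χ).ex.Realize Empty.elim xs :=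
    BoundedFormula.realize_ex.2 ⟨a, BoundedFormula.realize_iInf.2 hχ1⟩
  obtain ⟨b, hb⟩ := BoundedFormula.realize_ex.1 ((h _).1 h1)
  rw [BoundedFormula.realize_iInf] at hb
  have hout : SameType L (Quotient.out (Quotient.mk (typeSetoid L M (n + 1)) (Fin.snoc ys b)))
      (Fin.snoc ys b : Fin (n + 1) → M) :=
    Quotient.mk_out (s := typeSetoid L M (n + 1)) _
  refine hχ2 _ (fun hh => hne b (hh.trans hout)) ((hout _).2 (hb _))

end SameType

/-! ### The Ryll-Nardzewski theorem -/

section RyllNardzewski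

variable {L : FirstOrder.Language.{u, v}} {M : Type w} [L.Structure M]

/-- In an infinite countable ω-categorical structure every set of formulas that is finitely
satisfiable is realized: by compactness it is realized in some countable model. -/
theorem OmegaCategorical.exists_realize [Countable L.Symbols] [Countable M] [Infinite M]
    (hM : OmegaCategorical L M) {n : ℕ} {ι : Type*} (φ : ι → L.BoundedFormula Empty n)
    (h : ∀ t : Finset ι, ∃ xs : Fin n → M, ∀ i ∈ t, (φ i).Realize Empty.elim xs) :
    ∃ xs : Fin n → M, ∀ i, (φ i).Realize Empty.elim xs := by
  classical
  rcases isEmpty_or_nonempty ι with hι | hι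
  · obtain ⟨xs, -⟩ := h ∅
    exact ⟨xs, fun i => hι.elim i⟩
  let e : ι → L[[Empty ⊕ Fin n]].Sentence := fun i => Formula.equivSentence (φ i).toFormula
  let T : ι → L[[Empty ⊕ Fin n]].Theory := fun i =>
    (L.lhomWithConstants (Empty ⊕ Fin n)).onTheory (L.completeTheory M) ∪ {e i}
  have hsat : Theory.IsSatisfiable (⋃ i, T i) := by
    rw [Theory.isSatisfiable_iUnion_iff_isSatisfiable_iUnion_finset]
    intro t
    obtain ⟨xs, hxs⟩ := h t
    let : (constantsOn (Empty ⊕ Fin n)).Structure M :=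
      constantsOn.structure (Sum.elim Empty.elim xs)
    have : M ⊨ (⋃ i ∈ t, T i) := by
      refine ⟨fun σ hσ => ?_⟩
      simp only [Set.mem_iUnion] at hσ
      obtain ⟨i, hi, hσ⟩ := hσ
      rcases hσ with hσ | hσ
      · have : M ⊨ (L.lhomWithConstants (Empty ⊕ Fin n)).onTheory (L.completeTheory M) :=
          (LHom.onTheory_model _ _).2 inferInstance
        exact Theory.realize_sentence_of_mem _ hσ
      · rw [Set.mem_singleton_iff.1 hσ]
        refine (Formula.realize_equivSentence M _).2 ?_
        rw [BoundedFormula.realize_toFormula]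
        convert hxs i hi using 1
        ext j
        rfl
    exact Theory.Model.isSatisfiable M
  have hsub : (L.lhomWithConstants (Empty ⊕ Fin n)).onTheory (L.completeTheory M) ⊆ ⋃ i, T i :=
    fun σ hσ => Set.mem_iUnion.2 ⟨hι.some, Or.inl hσ⟩
  have hinf (N : Theory.ModelType (⋃ i, T i)) : Infinite N := by
    let N' := (N.subtheoryModel hsub).reduct (L.lhomWithConstants (Empty ⊕ Fin n))
    have : M ≅[L] N' := elementarilyEquivalent_iff.2 fun σ =>
      (realize_iff_of_model_completeTheory M N' σ).symm
    exact this.infinite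
  have hcard : Cardinal.lift.{w} (L[[Empty ⊕ Fin n]]).card ≤
      Cardinal.lift.{max u v} Cardinal.aleph0.{w} := by
    rw [Cardinal.lift_aleph0, Cardinal.lift_le_aleph0]
    exact Cardinal.mk_le_aleph0
  obtain ⟨N, hN⟩ := Theory.exists_model_card_eq ⟨hsat.some, hinf _⟩ Cardinal.aleph0.{w} le_rfl hcard
  let N' := (N.subtheoryModel hsub).reduct (L.lhomWithConstants (Empty ⊕ Fin n))
  obtain ⟨f⟩ := hM N' (Theory.ModelType.of _ M) hN (Cardinal.mk_eq_aleph0 M)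
  let c : Fin n → N := fun j => (L.con (Sum.inr j : Empty ⊕ Fin n) : N)
  refine ⟨fun j => f (c j), fun i => ?_⟩
  have hi : N ⊨ e i :=
    Theory.realize_sentence_of_mem (⋃ i, T i) (Set.mem_iUnion.2 ⟨i, Or.inr rfl⟩)
  let : L.Structure N := N'.struc
  have : (L.lhomWithConstants (Empty ⊕ Fin n)).IsExpansionOn N :=
    LHom.isExpansionOn_reduct _ _
  have h2 := (BoundedFormula.realize_toFormula _ _).1 ((Formula.realize_equivSentence N _).1 hi)
  have h3 := (StrongHomClass.realize_boundedFormula f (φ i)).2 h2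
  have key (v : Empty → M) (h : (φ i).Realize v fun j => f (c j)) :
      (φ i).Realize Empty.elim fun j => f (c j) := by
    rwa [Subsingleton.elim v Empty.elim] at h
  exact key _ h3

/-- A tuple whose type is isolated, that is, generated by a single formula. -/
def Isolated (L : FirstOrder.Language.{u, v}) {M : Type w} [L.Structure M] {n : ℕ}
    (xs : Fin n → M) : Prop :=
  ∃ χ : L.BoundedFormula Empty n, χ.Realize Empty.elim xs ∧
    ∀ ys : Fin n → M, χ.Realize Empty.elim ys → SameType L xs ys

theorem Isolated.of_sameType {n : ℕ} {xs ys : Fin n → M} (h : Isolated L xs)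
    (hxy : SameType L xs ys) : Isolated L ys := by
  obtain ⟨χ, h1, h2⟩ := h
  exact ⟨χ, (hxy χ).1 h1, fun zs hz => hxy.symm.trans (h2 zs hz)⟩

/-- The entries of an isolated tuple, in any order, form an isolated tuple: its type is generated by
the formula saying that the other entries exist. -/
theorem Isolated.comp {m n : ℕ} {xs : Fin n → M} (h : Isolated L xs) (g : Fin m → Fin n) :
    Isolated L (xs ∘ g) := by
  obtain ⟨χ, h1, h2⟩ := h
  let F : L.Formula (Fin m ⊕ Fin n) := (χ.toFormula.relabel (Sum.elim Empty.elim Sum.inr)) ⊓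
    Formula.iInf fun i : Fin m => Term.equal (Term.var (Sum.inl i)) (Term.var (Sum.inr (g i)))
  have hF (ys : Fin m → M) (zs : Fin n → M) :
      F.Realize (Sum.elim ys zs) ↔ χ.Realize Empty.elim zs ∧ ys = zs ∘ g := by
    rw [Formula.realize_inf, Formula.realize_relabel, BoundedFormula.realize_toFormula]
    refine and_congr (iff_of_eq ?_) ?_
    · congr 1
      exact Subsingleton.elim _ _
    · simp [funext_iff]
  have hE (ys : Fin m → M) : (BoundedFormula.relabel Sum.inr (F.iExs (Fin n)) :
      L.BoundedFormula Empty m).Realize Empty.elim ys ↔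
      ∃ zs : Fin n → M, χ.Realize Empty.elim zs ∧ ys = zs ∘ g := by
    rw [Formula.realize_relabel_sumInr, Formula.realize_iExs]
    simp only [hF]
  refine ⟨_, (hE _).2 ⟨xs, h1, rfl⟩, fun ys hys => ?_⟩
  obtain ⟨zs, hz, rfl⟩ := (hE _).1 hys
  exact (h2 zs hz).comp g

/-- Isolated types are dense. Otherwise a descending chain of satisfiable formulas can avoid, one
by one, all tuples of the countable structure, although it is finitely satisfiable. -/
theorem OmegaCategorical.exists_isolated [Countable L.Symbols] [Countable M] [Infinite M]
    (hM : OmegaCategorical L M) {n : ℕ} (θ : L.BoundedFormula Empty n)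
    (h : ∃ xs : Fin n → M, θ.Realize Empty.elim xs) :
    ∃ xs : Fin n → M, θ.Realize Empty.elim xs ∧ Isolated L xs := by
  by_contra! hne
  obtain ⟨e, he⟩ := exists_surjective_nat (Fin n → M)
  let S := {ψ : L.BoundedFormula Empty n // (∃ xs : Fin n → M, ψ.Realize Empty.elim xs) ∧
    ∀ xs : Fin n → M, ψ.Realize Empty.elim xs → θ.Realize Empty.elim xs}
  have step (k : ℕ) (s : S) : ∃ s' : S, (∀ xs : Fin n → M, s'.1.Realize Empty.elim xs →
      s.1.Realize Empty.elim xs) ∧ ¬ s'.1.Realize Empty.elim (e k) := by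
    obtain ⟨ψ, ⟨xs, hxs⟩, hψ⟩ := s
    have h1 := hne xs (hψ xs hxs)
    simp only [Isolated, not_exists, not_and, not_forall] at h1
    obtain ⟨ys, hys, hxy⟩ := h1 ψ hxs
    obtain ⟨φ, hφ⟩ := not_forall.1 hxy
    have hpos : ∃ zs : Fin n → M, (ψ ⊓ φ).Realize Empty.elim zs := by
      by_cases hx : φ.Realize Empty.elim xs
      · exact ⟨xs, BoundedFormula.realize_inf.2 ⟨hxs, hx⟩⟩
      · exact ⟨ys, BoundedFormula.realize_inf.2 ⟨hys, by tauto⟩⟩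
    have hneg : ∃ zs : Fin n → M, (ψ ⊓ φ.not).Realize Empty.elim zs := by
      by_cases hx : φ.Realize Empty.elim xs
      · exact ⟨ys, BoundedFormula.realize_inf.2 ⟨hys, by rw [BoundedFormula.realize_not]; tauto⟩⟩
      · exact ⟨xs, BoundedFormula.realize_inf.2 ⟨hxs, by rwa [BoundedFormula.realize_not]⟩⟩
    by_cases hk : φ.Realize Empty.elim (e k)
    · refine ⟨⟨ψ ⊓ φ.not, hneg, fun zs hz => hψ zs (BoundedFormula.realize_inf.1 hz).1⟩,
        fun zs hz => (BoundedFormula.realize_inf.1 hz).1, fun hz => ?_⟩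
      exact BoundedFormula.realize_not.1 (BoundedFormula.realize_inf.1 hz).2 hk
    · exact ⟨⟨ψ ⊓ φ, hpos, fun zs hz => hψ zs (BoundedFormula.realize_inf.1 hz).1⟩,
        fun zs hz => (BoundedFormula.realize_inf.1 hz).1,
        fun hz => hk (BoundedFormula.realize_inf.1 hz).2⟩
  choose next hnext1 hnext2 using step
  let s : ℕ → S := fun k => Nat.rec ⟨θ, h, fun _ => id⟩ next k
  have hanti (i j : ℕ) (hij : i ≤ j) (xs : Fin n → M) (hx : (s j).1.Realize Empty.elim xs) :
      (s i).1.Realize Empty.elim xs := by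
    induction j, hij using Nat.le_induction with
    | base => exact hx
    | succ j _ ih => exact ih (hnext1 j (s j) xs hx)
  obtain ⟨xs, hxs⟩ := hM.exists_realize (fun k => (s k).1) fun t => by
    obtain ⟨xs, hxs⟩ := (s (t.sup id)).2.1
    exact ⟨xs, fun i hi => hanti i _ (Finset.le_sup (f := id) hi) xs hxs⟩
  obtain ⟨k, rfl⟩ := he xs
  exact hnext2 k (s k) (hxs (k + 1))

/-- An isolated tuple can be extended to an isolated tuple whose last entry satisfies a given
satisfiable condition. -/
theorem OmegaCategorical.exists_isolated_snoc [Countable L.Symbols] [Countable M] [Infinite M]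
    (hM : OmegaCategorical L M) {n : ℕ} {xs : Fin n → M} (hxs : Isolated L xs)
    (θ : L.BoundedFormula Empty (n + 1)) (a : M)
    (h : θ.Realize Empty.elim (Fin.snoc xs a : Fin (n + 1) → M)) :
    ∃ b : M, θ.Realize Empty.elim (Fin.snoc xs b : Fin (n + 1) → M) ∧
      Isolated L (Fin.snoc xs b : Fin (n + 1) → M) := by
  obtain ⟨χ, h1, h2⟩ := hxs
  obtain ⟨χ', hχ'⟩ := exists_substitution (M := M) χ
    fun i : Fin n => (Term.var (Sum.inr i.castSucc) : L.Term (Empty ⊕ Fin (n + 1)))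
  simp only [Term.realize_var, Sum.elim_inr] at hχ'
  -- an isolated tuple with both properties need not extend `xs`, but its first entries have the
  -- type of `xs`, so that its last entry can be carried over
  obtain ⟨zs, hz, hiso⟩ := hM.exists_isolated (θ ⊓ χ') ⟨Fin.snoc xs a,
    BoundedFormula.realize_inf.2 ⟨h, (hχ' _).2 (by simpa using h1)⟩⟩
  obtain ⟨hzθ, hzχ⟩ := BoundedFormula.realize_inf.1 hz
  have hsame := h2 _ ((hχ' _).1 hzχ)
  obtain ⟨ρ, hρ1, hρ2⟩ := hiso
  have hex : ρ.ex.Realize Empty.elim (fun i : Fin n => zs i.castSucc) := by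
    refine BoundedFormula.realize_ex.2 ⟨zs (Fin.last n), ?_⟩
    convert hρ1 using 1
    exact Fin.snoc_init_self zs
  obtain ⟨b, hb⟩ := BoundedFormula.realize_ex.1 ((hsame _).2 hex)
  have hzb := hρ2 _ hb
  exact ⟨b, (hzb θ).1 hzθ, ⟨ρ, hb, fun ys hy => hzb.symm.trans (hρ2 ys hy)⟩⟩

/-- A sequence all of whose initial segments are isolated, and whose range is a witness set for all
satisfiable formulas with parameters in it. It is built by recursion: each pair of a formula and
parameters is dealt with at infinitely many stages. -/
theorem OmegaCategorical.exists_atomic_sequence [Countable L.Symbols] [Countable M] [Infinite M]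
    (hM : OmegaCategorical L M) :
    ∃ a : ℕ → M, (∀ n, Isolated L fun i : Fin n => a i) ∧
      ∀ (m : ℕ) (φ : L.BoundedFormula Empty (m + 1)) (g : Fin m → ℕ) (c : M),
        φ.Realize Empty.elim (Fin.snoc (fun i => a (g i)) c : Fin (m + 1) → M) →
        ∃ k, φ.Realize Empty.elim (Fin.snoc (fun i => a (g i)) (a k) : Fin (m + 1) → M) := by
  classical
  let Task := Σ m, L.BoundedFormula Empty (m + 1) × (Fin m → ℕ)
  have hcount (m : ℕ) : Countable (L.BoundedFormula Empty (m + 1)) :=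
    Function.Injective.countable (f := fun φ => (⟨m + 1, φ⟩ : Σ n, L.BoundedFormula Empty n))
      fun _ _ h => by simpa using h
  have : Nonempty Task := ⟨⟨0, ⊤, Fin.elim0⟩⟩
  obtain ⟨e, he⟩ := exists_surjective_nat Task
  have step (n : ℕ) (τ : Task) (xs : {xs : Fin n → M // Isolated L xs}) :
      ∃ b : M, Isolated L (Fin.snoc xs.1 b : Fin (n + 1) → M) ∧
        ∀ (h : ∀ i, τ.2.2 i < n) (c : M),
          τ.2.1.Realize Empty.elim (Fin.snoc (fun i => xs.1 ⟨τ.2.2 i, h i⟩) c) →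
          τ.2.1.Realize Empty.elim (Fin.snoc (fun i => xs.1 ⟨τ.2.2 i, h i⟩) b) := by
    obtain ⟨m, φ, g⟩ := τ
    obtain ⟨xs, hxs⟩ := xs
    by_cases hex : ∃ (h : ∀ i, g i < n) (c : M),
        φ.Realize Empty.elim (Fin.snoc (fun i => xs ⟨g i, h i⟩) c : Fin (m + 1) → M)
    · obtain ⟨h, c, hc⟩ := hex
      obtain ⟨θ, hθ⟩ := exists_substitution (M := M) φ fun i : Fin (m + 1) =>
        (Term.var (Sum.inr (Fin.snoc (α := fun _ => Fin (n + 1))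
          (fun i => (⟨g i, h i⟩ : Fin n).castSucc) (Fin.last n) i)) :
            L.Term (Empty ⊕ Fin (n + 1)))
      have hθ' (b : M) : θ.Realize Empty.elim (Fin.snoc xs b : Fin (n + 1) → M) ↔
          φ.Realize Empty.elim (Fin.snoc (fun i => xs ⟨g i, h i⟩) b : Fin (m + 1) → M) := by
        rw [hθ]
        refine iff_of_eq ?_
        congr 1
        funext i
        refine Fin.lastCases ?_ (fun i => ?_) i
        · simp
        · simp only [Term.realize_var, Sum.elim_inr, Fin.snoc_castSucc]
      obtain ⟨b, hb1, hb2⟩ := hM.exists_isolated_snoc hxs θ c ((hθ' c).2 hc)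
      exact ⟨b, hb2, fun _ _ _ => (hθ' b).1 hb1⟩
    · obtain ⟨b, -, hb2⟩ := hM.exists_isolated_snoc hxs ⊤ (Classical.arbitrary M) (by simp)
      exact ⟨b, hb2, fun h c hc => absurd ⟨h, c, hc⟩ hex⟩
  choose next hnext1 hnext2 using step
  have h0 : Isolated L (default : Fin 0 → M) :=
    ⟨⊤, by simp, fun ys _ => by rw [Subsingleton.elim ys default]; exact SameType.refl _⟩
  let task : ℕ → Task := fun n => e n.unpair.1
  let s : ∀ n, {xs : Fin n → M // Isolated L xs} := fun n =>
    Nat.rec ⟨default, h0⟩ (fun n xs => ⟨Fin.snoc xs.1 (next n (task n) xs), hnext1 n _ xs⟩) n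
  let a : ℕ → M := fun n => next n (task n) (s n)
  have hs (n : ℕ) : (s n).1 = fun i : Fin n => a i := by
    induction n with
    | zero => exact Subsingleton.elim _ _
    | succ n ih =>
      have : (s (n + 1)).1 = Fin.snoc (s n).1 (a n) := rfl
      rw [this, ih]
      funext i
      refine Fin.lastCases ?_ (fun i => ?_) i
      · simp
      · simp
  refine ⟨a, fun n => hs n ▸ (s n).2, fun m φ g c hc => ?_⟩
  obtain ⟨k, hk⟩ := he ⟨m, φ, g⟩
  -- a stage at which this task is dealt with, after all of its parameters have been chosen
  let n := Nat.pair k (Finset.univ.sup g + 1)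
  have hn (i : Fin m) : g i < n :=
    (Nat.lt_succ_of_le (Finset.le_sup (Finset.mem_univ i))).trans_le (Nat.right_le_pair _ _)
  have htask : task n = ⟨m, φ, g⟩ := by simp [task, n, hk]
  refine ⟨n, ?_⟩
  have h1 := hnext2 n ⟨m, φ, g⟩ (s n) hn c
  simp only [hs] at h1
  have h2 := h1 hc
  rw [← htask] at h2
  exact h2

/-- Every tuple of an infinite countable ω-categorical structure has an isolated type, since the
structure is isomorphic to an atomic elementary substructure of itself. -/
theorem OmegaCategorical.isolated [Countable L.Symbols] [Countable M] [Infinite M]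
    (hM : OmegaCategorical L M) {n : ℕ} (xs : Fin n → M) : Isolated L xs := by
  obtain ⟨a, ha, hwit⟩ := hM.exists_atomic_sequence
  have hclosed {m : ℕ} (f : L.Functions m) (x : Fin m → M) (hx : ∀ i, x i ∈ Set.range a) :
      Structure.funMap f x ∈ Set.range a := by
    choose g hg using hx
    obtain ⟨k, hk⟩ := hwit m (Term.bdEqual (Term.var (Sum.inr (Fin.last m)))
      (Term.func f fun i => Term.var (Sum.inr i.castSucc))) g (Structure.funMap f x)
      (by simp [hg])
    refine ⟨k, ?_⟩
    simpa [hg] using hk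
  let S₀ : L.Substructure M := ⟨Set.range a, fun f x hx => hclosed f x hx⟩
  let S : L.ElementarySubstructure M := S₀.toElementarySubstructure fun m φ x c hc => by
    choose g hg using fun i => (x i).2
    have hx : (Subtype.val ∘ x : Fin m → M) = fun i => a (g i) := funext fun i => (hg i).symm
    rw [hx] at hc ⊢
    rw [Subsingleton.elim (default : Empty → M) Empty.elim] at hc ⊢
    obtain ⟨k, hk⟩ := hwit m φ g c hc
    exact ⟨⟨a k, k, rfl⟩, hk⟩
  have hSM : S ≅[L] M := S.elementarilyEquivalent
  have : Infinite S := hSM.symm.infinite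
  have : Nonempty S := inferInstance
  have : S ⊨ L.completeTheory M := hSM.symm.theory_model
  obtain ⟨f⟩ := hM (Theory.ModelType.of _ M) (Theory.ModelType.of _ S) (Cardinal.mk_eq_aleph0 M)
    (Cardinal.mk_eq_aleph0 S)
  change M ≃[L] S at f
  have hsame : SameType L (fun i => (f (xs i) : M)) xs := fun φ => by
    have h1 := StrongHomClass.realize_boundedFormula f φ (v := Empty.elim) (xs := xs)
    have h2 := S.subtype.map_boundedFormula φ (f ∘ Empty.elim) (f ∘ xs)
    rw [h1, Subsingleton.elim (S.subtype ∘ _) (Empty.elim : Empty → M)] at h2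
    exact h2
  refine Isolated.of_sameType ?_ hsame
  choose g hg using fun i => (f (xs i)).2
  have hlt (i : Fin n) : g i < Finset.univ.sup g + 1 :=
    Nat.lt_succ_of_le (Finset.le_sup (Finset.mem_univ i))
  have := (ha (Finset.univ.sup g + 1)).comp fun i => ⟨g i, hlt i⟩
  simpa [Function.comp_def, hg] using this

/-- The Ryll-Nardzewski theorem: a countable ω-categorical structure realizes only finitely many
types of `n`-tuples. In the infinite case the types are all isolated, and by saturation finitely
many of the isolating formulas cover all tuples. -/
theorem OmegaCategorical.finite_types [Countable L.Symbols] [Countable M]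
    (hM : OmegaCategorical L M) (n : ℕ) : Finite (Quotient (typeSetoid L M n)) := by
  rcases finite_or_infinite M with hfin | hinf
  · infer_instance
  choose χ hχ1 hχ2 using fun xs : Fin n → M => hM.isolated xs
  obtain ⟨t, ht⟩ : ∃ t : Finset (Fin n → M), ∀ ys : Fin n → M, ∃ xs ∈ t,
      (χ xs).Realize Empty.elim ys := by
    by_contra! hne
    obtain ⟨ys, hys⟩ := hM.exists_realize (fun xs => (χ xs).not) fun t => by
      simpa using hne t
    exact (BoundedFormula.realize_not.1 (hys ys)) (hχ1 ys)
  refine Finite.of_surjective (fun xs : t => Quotient.mk (typeSetoid L M n) xs) fun q => ?_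
  induction q using Quotient.inductionOn with
  | h ys =>
    obtain ⟨xs, hxs, h⟩ := ht ys
    exact ⟨⟨xs, hxs⟩, Quotient.sound (s := typeSetoid L M n) (hχ2 xs ys h)⟩

end RyllNardzewski

/-! ### First-order formulas with relation variables -/

/-- First-order formulas over `L` with free relation variables: the formulas without fixed-point
operators. Element variables and relation variables are as in `PFPFormula`. As no relation variable
is bound, the list `Γ` of arities is a parameter. -/
inductive RelFormula (L : FirstOrder.Language.{u, v}) (Γ : List ℕ) : ℕ → Type (max u v)
  | falsum {n : ℕ} : RelFormula L Γ n
  | equal {n : ℕ} (t₁ t₂ : L.Term (Empty ⊕ Fin n)) : RelFormula L Γ n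
  | rel {n l : ℕ} (R : L.Relations l) (ts : Fin l → L.Term (Empty ⊕ Fin n)) : RelFormula L Γ n
  | relVar {n : ℕ} (i : Fin Γ.length) (ts : Fin (Γ.get i) → L.Term (Empty ⊕ Fin n)) :
      RelFormula L Γ n
  | imp {n : ℕ} (φ ψ : RelFormula L Γ n) : RelFormula L Γ n
  | all {n : ℕ} (φ : RelFormula L Γ (n + 1)) : RelFormula L Γ n

section Terms

variable {L : FirstOrder.Language.{u, v}} {M : Type w} [L.Structure M]

/-- The variable `xᵢ` as a term. -/
abbrev varTerm {n : ℕ} (i : Fin n) : L.Term (Empty ⊕ Fin n) := Term.var (Sum.inr i)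

/-- Simultaneous substitution of terms for the variables of a term. -/
def substTerm {n m : ℕ} (t : L.Term (Empty ⊕ Fin n)) (σ : Fin n → L.Term (Empty ⊕ Fin m)) :
    L.Term (Empty ⊕ Fin m) :=
  t.subst (Sum.elim Empty.elim σ)

/-- A substitution extended to one more variable, which is sent to the new last variable. -/
def liftSubst {n m : ℕ} (σ : Fin n → L.Term (Empty ⊕ Fin m)) :
    Fin (n + 1) → L.Term (Empty ⊕ Fin (m + 1)) :=
  Fin.snoc (α := fun _ => L.Term (Empty ⊕ Fin (m + 1)))
    (fun i => (σ i).relabel (Sum.map id Fin.castSucc)) (varTerm (Fin.last m))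

/-- The values of a tuple of terms. -/
def termValues {n m : ℕ} (σ : Fin n → L.Term (Empty ⊕ Fin m)) (xs : Fin m → M) : Fin n → M :=
  fun i => (σ i).realize (Sum.elim Empty.elim xs)

theorem realize_substTerm {n m : ℕ} (t : L.Term (Empty ⊕ Fin n))
    (σ : Fin n → L.Term (Empty ⊕ Fin m)) (xs : Fin m → M) :
    (substTerm t σ).realize (Sum.elim Empty.elim xs) =
      t.realize (Sum.elim Empty.elim (termValues σ xs)) := by
  rw [substTerm, Term.realize_subst]
  congr 1
  funext j
  rcases j with j | j
  · exact j.elim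
  · rfl

theorem termValues_liftSubst {n m : ℕ} (σ : Fin n → L.Term (Empty ⊕ Fin m)) (xs : Fin m → M)
    (a : M) : termValues (liftSubst σ) (Fin.snoc xs a : Fin (m + 1) → M) =
      Fin.snoc (termValues σ xs) a := by
  funext i
  refine Fin.lastCases ?_ (fun i => ?_) i
  · simp [termValues, liftSubst]
  · simp only [termValues, liftSubst, Fin.snoc_castSucc, Term.realize_relabel]
    congr 1
    funext j
    rcases j with j | j
    · exact j.elim
    · simp

theorem termValues_append {n m k : ℕ} (σ : Fin n → L.Term (Empty ⊕ Fin m))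
    (τ : Fin k → L.Term (Empty ⊕ Fin m)) (xs : Fin m → M) :
    termValues (Fin.append σ τ) xs = Fin.append (termValues σ xs) (termValues τ xs) := by
  funext i
  refine Fin.addCases (fun i => ?_) (fun i => ?_) i <;> simp [termValues]

theorem termValues_castLE {n m : ℕ} (h : n ≤ m) (xs : Fin m → M) :
    termValues (fun i : Fin n => (varTerm (i.castLE h) : L.Term (Empty ⊕ Fin m))) xs =
      fun i => xs (i.castLE h) := rfl

end Terms

namespace RelFormula

variable {L : FirstOrder.Language.{u, v}} {M : Type w} [L.Structure M] {Γ : List ℕ}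

/-- Satisfaction in `M`. -/
def Realize : {n : ℕ} → RelFormula L Γ n → RelEnv M Γ → (Fin n → M) → Prop
  | _, .falsum, _, _ => False
  | _, .equal t₁ t₂, _, xs =>
      t₁.realize (Sum.elim Empty.elim xs) = t₂.realize (Sum.elim Empty.elim xs)
  | _, .rel R ts, _, xs => Structure.RelMap R (termValues ts xs)
  | _, .relVar i ts, ρ, xs => termValues ts xs ∈ ρ i
  | _, .imp φ ψ, ρ, xs => φ.Realize ρ xs → ψ.Realize ρ xs
  | _, .all φ, ρ, xs => ∀ a : M, φ.Realize ρ (Fin.snoc xs a)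

/-- Simultaneous substitution of terms for the free element variables. -/
def subst : {n m : ℕ} → RelFormula L Γ n → (Fin n → L.Term (Empty ⊕ Fin m)) → RelFormula L Γ m
  | _, _, .falsum, _ => .falsum
  | _, _, .equal t₁ t₂, σ => .equal (substTerm t₁ σ) (substTerm t₂ σ)
  | _, _, .rel R ts, σ => .rel R fun i => substTerm (ts i) σ
  | _, _, .relVar i ts, σ => .relVar i fun j => substTerm (ts j) σ
  | _, _, .imp φ ψ, σ => .imp (φ.subst σ) (ψ.subst σ)
  | _, _, .all φ, σ => .all (φ.subst (liftSubst σ))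

theorem realize_subst {n m : ℕ} (φ : RelFormula L Γ n) (σ : Fin n → L.Term (Empty ⊕ Fin m))
    (ρ : RelEnv M Γ) (xs : Fin m → M) :
    (φ.subst σ).Realize ρ xs ↔ φ.Realize ρ (termValues σ xs) := by
  have hts {n m l : ℕ} (ts : Fin l → L.Term (Empty ⊕ Fin n)) (σ : Fin n → L.Term (Empty ⊕ Fin m))
      (xs : Fin m → M) :
      termValues (fun i => substTerm (ts i) σ) xs = termValues ts (termValues σ xs) :=
    funext fun i => realize_substTerm (ts i) σ xs
  induction φ generalizing m with
  | falsum => rfl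
  | equal t₁ t₂ => simp only [subst, Realize, realize_substTerm]
  | rel R ts => simp only [subst, Realize, hts]
  | relVar i ts => simp only [subst, Realize, hts]
  | imp φ ψ ihφ ihψ => simp only [subst, Realize, ihφ, ihψ]
  | all φ ih => simp only [subst, Realize, ih, termValues_liftSubst]

/-- The atom `R(ts)` for a relation variable `R`, with the formula `ψ` in place of the relation
variable `0`. The first `n` variables of `ψ` are parameters. -/
def instantiateAtom {k n m : ℕ} (h : n ≤ m) (ψ : RelFormula L Γ (n + k)) :
    (i : Fin (k :: Γ).length) → (Fin ((k :: Γ).get i) → L.Term (Empty ⊕ Fin m)) →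
      RelFormula L Γ m
  | ⟨0, _⟩, ts => ψ.subst (Fin.append (fun j : Fin n => varTerm (j.castLE h)) ts)
  | ⟨i + 1, hi⟩, ts => .relVar ⟨i, Nat.lt_of_succ_lt_succ hi⟩ ts

/-- Replace the relation variable `0` by the relation that the formula `ψ` defines with the values
of the first `n` variables as parameters. -/
def instantiate {k n : ℕ} (ψ : RelFormula L Γ (n + k)) :
    {m : ℕ} → RelFormula L (k :: Γ) m → n ≤ m → RelFormula L Γ m
  | _, .falsum, _ => .falsum
  | _, .equal t₁ t₂, _ => .equal t₁ t₂
  | _, .rel R ts, _ => .rel R ts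
  | _, .relVar i ts, h => instantiateAtom h ψ i ts
  | _, .imp φ φ', h => .imp (instantiate ψ φ h) (instantiate ψ φ' h)
  | _, .all φ, h => .all (instantiate ψ φ (Nat.le_succ_of_le h))

theorem realize_instantiate {k n m : ℕ} (ψ : RelFormula L Γ (n + k))
    (φ : RelFormula L (k :: Γ) m) (h : n ≤ m) (ρ : RelEnv M Γ) (xs : Fin m → M) :
    (instantiate ψ φ h).Realize ρ xs ↔ φ.Realize
      (RelEnv.cons {ys | ψ.Realize ρ (Fin.append (fun i => xs (i.castLE h)) ys)} ρ) xs := by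
  induction φ with
  | falsum => rfl
  | equal t₁ t₂ => rfl
  | rel R ts => rfl
  | relVar i ts =>
    obtain ⟨i, hi⟩ := i
    cases i with
    | zero =>
      refine (realize_subst _ _ _ _).trans ?_
      rw [termValues_append, termValues_castLE]
      rfl
    | succ i => rfl
  | imp φ φ' ihφ ihφ' => simp only [instantiate, Realize, ihφ, ihφ']
  | all φ ih =>
    simp only [instantiate, Realize, ih]
    refine forall_congr' fun a => ?_
    have (i : Fin n) : (Fin.snoc xs a : Fin _ → M) (i.castLE (Nat.le_succ_of_le h)) =
        xs (i.castLE h) := Fin.snoc_castSucc (α := fun _ => M) a xs (i.castLE h)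
    simp only [this]

/-- Conjunction. -/
def and {n : ℕ} (φ ψ : RelFormula L Γ n) : RelFormula L Γ n := (φ.imp (ψ.imp falsum)).imp falsum

@[simp]
theorem realize_and {n : ℕ} (φ ψ : RelFormula L Γ n) (ρ : RelEnv M Γ) (xs : Fin n → M) :
    (φ.and ψ).Realize ρ xs ↔ φ.Realize ρ xs ∧ ψ.Realize ρ xs := by
  simp only [and, Realize]
  tauto

/-- Universal quantification over the last `k` variables. -/
def alls {n : ℕ} : (k : ℕ) → RelFormula L Γ (n + k) → RelFormula L Γ n
  | 0, φ => φ
  | k + 1, φ => alls k φ.all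

theorem realize_alls {n k : ℕ} (φ : RelFormula L Γ (n + k)) (ρ : RelEnv M Γ) (xs : Fin n → M) :
    (φ.alls k).Realize ρ xs ↔ ∀ ys : Fin k → M, φ.Realize ρ (Fin.append xs ys) := by
  induction k with
  | zero =>
    rw [alls]
    refine ⟨fun h ys => ?_, fun h => ?_⟩
    · rwa [Subsingleton.elim ys Fin.elim0, Fin.append_elim0]
    · have := h Fin.elim0
      rwa [Fin.append_elim0] at this
  | succ k ih =>
    rw [alls, ih]
    refine ⟨fun h ys => ?_, fun h ys a => ?_⟩
    · rw [← Fin.snoc_init_self ys, Fin.append_snoc]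
      exact h _ _
    · rw [← Fin.append_snoc]
      exact h _

/-- Equivalence of two formulas, for all values of the last `k` variables. -/
def equiv {n : ℕ} (k : ℕ) (φ ψ : RelFormula L Γ (n + k)) : RelFormula L Γ n :=
  ((φ.imp ψ).and (ψ.imp φ)).alls k

theorem realize_equiv {n k : ℕ} (φ ψ : RelFormula L Γ (n + k)) (ρ : RelEnv M Γ) (xs : Fin n → M) :
    (equiv k φ ψ).Realize ρ xs ↔
      {ys : Fin k → M | φ.Realize ρ (Fin.append xs ys)} =
        {ys : Fin k → M | ψ.Realize ρ (Fin.append xs ys)} := by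
  simp only [equiv, realize_alls, realize_and, Realize, Set.ext_iff, Set.mem_ofPred_eq, iff_def]

/-- The conjunction of `f 0, …, f (j - 1)`. -/
def conj {n : ℕ} (f : ℕ → RelFormula L Γ n) : ℕ → RelFormula L Γ n
  | 0 => falsum.imp falsum
  | j + 1 => (conj f j).and (f j)

theorem realize_conj {n : ℕ} (f : ℕ → RelFormula L Γ n) (j : ℕ) (ρ : RelEnv M Γ)
    (xs : Fin n → M) : (conj f j).Realize ρ xs ↔ ∀ i < j, (f i).Realize ρ xs := by
  induction j with
  | zero => simp [conj, Realize]
  | succ j ih => simp only [conj, realize_and, ih, Nat.forall_lt_succ_right]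

/-- The operator on `k`-ary relations that is defined by `φ` with the parameters `xs`. -/
def operator {n k : ℕ} (φ : RelFormula L (k :: Γ) (n + k)) (ρ : RelEnv M Γ) (xs : Fin n → M)
    (S : Set (Fin k → M)) : Set (Fin k → M) :=
  {ys | φ.Realize (RelEnv.cons S ρ) (Fin.append xs ys)}

/-- The formula that defines stage `j` of the iteration, starting from `∅`, of the operator that is
defined by `φ`. -/
def stage {k n : ℕ} (φ : RelFormula L (k :: Γ) (n + k)) : ℕ → RelFormula L Γ (n + k)
  | 0 => falsum
  | j + 1 => instantiate (stage φ j) φ (Nat.le_add_right n k)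

/-- The stage formulas define the stages: the parameters are the same at every stage, so only the
relation is substituted. -/
theorem setOf_realize_stage {k n : ℕ} (φ : RelFormula L (k :: Γ) (n + k)) (j : ℕ)
    (ρ : RelEnv M Γ) (xs : Fin n → M) :
    {ys : Fin k → M | (stage φ j).Realize ρ (Fin.append xs ys)} =
      (φ.operator ρ xs)^[j] ∅ := by
  have happ (ys : Fin k → M) (i : Fin n) :
      Fin.append xs ys (i.castLE (Nat.le_add_right n k)) = xs i := Fin.append_left xs ys i
  induction j with
  | zero => simp [stage, Realize]
  | succ j ih =>
    rw [Function.iterate_succ_apply', ← ih]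
    simp only [stage, realize_instantiate, happ, operator]

/-- A formula without relation variables as a first-order formula. -/
def toBoundedFormula : {n : ℕ} → RelFormula L [] n → L.BoundedFormula Empty n
  | _, .falsum => .falsum
  | _, .equal t₁ t₂ => .equal t₁ t₂
  | _, .rel R ts => .rel R ts
  | _, .relVar i _ => i.elim0
  | _, .imp φ ψ => .imp φ.toBoundedFormula ψ.toBoundedFormula
  | _, .all φ => .all φ.toBoundedFormula

theorem realize_toBoundedFormula {n : ℕ} (φ : RelFormula L [] n) (xs : Fin n → M) :
    φ.toBoundedFormula.Realize Empty.elim xs ↔ φ.Realize RelEnv.nil xs := by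
  induction φ with
  | falsum => rfl
  | equal t₁ t₂ => rfl
  | rel R ts => rfl
  | relVar i ts => exact i.elim0
  | imp φ ψ ihφ ihψ => exact imp_congr (ihφ xs) (ihψ xs)
  | all φ ih => exact forall_congr' fun a => ih (Fin.snoc xs a)

end RelFormula

/-! ### Periodic sequences of stages -/

section PartialFixedPoint

variable {A : Type*} (F : Set A → Set A)

/-- If stage `p > 0` of the iteration coincides with stage `2 * p`, then the partial fixed point is
stage `p` or empty, according to whether stage `p` is stationary. -/
theorem mem_partialFixedPoint_iff_of_period {p : ℕ} (hp : 0 < p)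
    (h : F^[p] ∅ = F^[2 * p] ∅) (a : A) :
    a ∈ partialFixedPoint F ↔ F^[p] ∅ = F^[p + 1] ∅ ∧ a ∈ F^[p] ∅ := by
  have hmul (m : ℕ) : F^[p * (m + 1)] ∅ = F^[p] ∅ := by
    induction m with
    | zero => simp
    | succ m ih =>
      rw [Nat.mul_succ, Nat.add_comm, Function.iterate_add_apply, ih, ← Function.iterate_add_apply,
        ← Nat.two_mul, h]
  constructor
  · rintro ⟨j, hj, ha⟩
    have hst (i : ℕ) (hi : j ≤ i) : F^[i] ∅ = F^[j] ∅ := by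
      induction i, hi using Nat.le_induction with
      | base => rfl
      | succ i _ ih => rw [Function.iterate_succ_apply', ih, ← Function.iterate_succ_apply' F, hj]
    have hle : j ≤ p * (j + 1) := (Nat.le_succ j).trans (Nat.le_mul_of_pos_left _ hp)
    have hpj : F^[p] ∅ = F^[j] ∅ := by rw [← hmul j, hst _ hle]
    refine ⟨?_, hpj ▸ ha⟩
    rw [Function.iterate_succ_apply', hpj, ← Function.iterate_succ_apply' F, hj]
  · rintro ⟨hst, ha⟩
    exact ⟨p, hst.symm, ha⟩

/-- If the stages of the iteration take at most `d` values, then the stages `p` and `2 * p` coincide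
for all multiples `p` of `d!`: the preperiod and the period are at most `d`. -/
theorem iterate_eq_iterate_two_mul {B : Type*} [Finite B] (e : Set A → B)
    (he : ∀ i j, e (F^[i] ∅) = e (F^[j] ∅) → F^[i] ∅ = F^[j] ∅) {p : ℕ} (hp : 0 < p)
    (hd : (Nat.card B).factorial ∣ p) : F^[p] ∅ = F^[2 * p] ∅ := by
  have hB := Fintype.ofFinite B
  obtain ⟨i, j, hij, heq⟩ := Fintype.exists_ne_map_eq_of_card_lt
    (fun i : Fin (Nat.card B + 1) => e (F^[i] ∅)) (by simp [Nat.card_eq_fintype_card])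
  wlog hlt : i < j generalizing i j
  · exact this j i hij.symm heq.symm (lt_of_le_of_ne (not_lt.1 hlt) hij.symm)
  have h0 := he _ _ heq
  set q : ℕ := (j : ℕ) - i with hq
  have hlt' : (i : ℕ) < j := hlt
  have hjd : (j : ℕ) ≤ Nat.card B := Nat.lt_succ_iff.1 j.2
  have hq0 : 0 < q := by omega
  have hperiod (n : ℕ) (hn : (i : ℕ) ≤ n) : F^[n + q] ∅ = F^[n] ∅ := by
    obtain ⟨m, rfl⟩ := Nat.exists_eq_add_of_le hn
    have h1 : (i : ℕ) + m + q = m + j := by omega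
    rw [h1, Function.iterate_add_apply, ← h0, ← Function.iterate_add_apply, Nat.add_comm]
  have hip : (i : ℕ) ≤ p :=
    (hlt'.le.trans hjd).trans ((Nat.self_le_factorial _).trans (Nat.le_of_dvd hp hd))
  have hmul (m : ℕ) : F^[p + q * m] ∅ = F^[p] ∅ := by
    induction m with
    | zero => rfl
    | succ m ih => rw [Nat.mul_succ, ← Nat.add_assoc, hperiod _ (by omega), ih]
  obtain ⟨m, hm⟩ : q ∣ p := (Nat.dvd_factorial hq0 (by omega)).trans hd
  have := hmul m
  rw [← hm, ← Nat.two_mul] at this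
  exact this.symm

end PartialFixedPoint

/-! ### Translation with a given period -/

section Translation

variable {L : FirstOrder.Language.{u, v}} {M : Type w} [L.Structure M]

/-- The translation with period `p`. The first component replaces every partial fixed point by its
stage `p`, provided that this stage is stationary. The second component guarantees that this is
correct: it says that wherever an operator is evaluated, its stages `p` and `2 * p` coincide. -/
def translation (p : ℕ) : {Γ : List ℕ} → {n : ℕ} → PFPFormula L Γ n →
    RelFormula L Γ n × RelFormula L Γ n
  | _, _, .falsum => (.falsum, .imp .falsum .falsum)
  | _, _, .equal t₁ t₂ => (.equal t₁ t₂, .imp .falsum .falsum)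
  | _, _, .rel R ts => (.rel R ts, .imp .falsum .falsum)
  | _, _, .relVar i ts => (.relVar i ts, .imp .falsum .falsum)
  | _, _, .imp φ ψ =>
      (.imp (translation p φ).1 (translation p ψ).1, (translation p φ).2.and (translation p ψ).2)
  | _, _, .all φ => (.all (translation p φ).1, .all (translation p φ).2)
  | _, n, .pfp k φ ts =>
      ((RelFormula.equiv k ((translation p φ).1.stage p) ((translation p φ).1.stage (p + 1))).and
          (((translation p φ).1.stage p).subst (Fin.append (fun j : Fin n => varTerm j) ts)),
        (RelFormula.equiv k ((translation p φ).1.stage p) ((translation p φ).1.stage (2 * p))).and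
          (RelFormula.conj (fun i => (RelFormula.instantiate ((translation p φ).1.stage i)
            (translation p φ).2 (Nat.le_add_right n k)).alls k) (2 * p)))

/-- The operator on `k`-ary relations that is defined by `φ` with the parameters `xs`. -/
def PFPFormula.operator {Γ : List ℕ} {n k : ℕ} (φ : PFPFormula L (k :: Γ) (n + k))
    (ρ : RelEnv M Γ) (xs : Fin n → M) (S : Set (Fin k → M)) : Set (Fin k → M) :=
  {ys | φ.Realize (RelEnv.cons S ρ) (Fin.append xs ys)}

/-- What the second component of the translation of `pfp k φ ts` says. -/
theorem realize_translation_pfp_snd (p : ℕ) {Γ : List ℕ} {n k : ℕ}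
    (φ : PFPFormula L (k :: Γ) (n + k)) (ts : Fin k → L.Term (Empty ⊕ Fin n)) (ρ : RelEnv M Γ)
    (xs : Fin n → M) :
    (translation p (.pfp k φ ts)).2.Realize ρ xs ↔
      ((translation p φ).1.operator ρ xs)^[p] ∅ = ((translation p φ).1.operator ρ xs)^[2 * p] ∅ ∧
      ∀ i < 2 * p, ∀ ys : Fin k → M, (translation p φ).2.Realize (RelEnv.cons
        (((translation p φ).1.operator ρ xs)^[i] ∅) ρ) (Fin.append xs ys) := by
  have happ (ys : Fin k → M) (i : Fin n) :
      Fin.append xs ys (i.castLE (Nat.le_add_right n k)) = xs i := Fin.append_left xs ys i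
  simp only [translation, RelFormula.realize_and, RelFormula.realize_equiv,
    RelFormula.realize_conj, RelFormula.realize_alls, RelFormula.realize_instantiate, happ,
    RelFormula.setOf_realize_stage]

/-- As long as the second component of the translation of `φ` holds for the stages before `j`, the
operators defined by `φ` and by the first component have the same stages up to `j`. -/
theorem iterate_translation_eq (p : ℕ) {Γ : List ℕ} {n k : ℕ} (φ : PFPFormula L (k :: Γ) (n + k))
    (ρ : RelEnv M Γ) (xs : Fin n → M)
    (ih : ∀ (S : Set (Fin k → M)) (ys : Fin k → M),
      (translation p φ).2.Realize (RelEnv.cons S ρ) (Fin.append xs ys) →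
      ((translation p φ).1.Realize (RelEnv.cons S ρ) (Fin.append xs ys) ↔
        φ.Realize (RelEnv.cons S ρ) (Fin.append xs ys))) (j : ℕ)
    (h : ∀ i < j, ∀ ys : Fin k → M, (translation p φ).2.Realize
      (RelEnv.cons ((φ.operator ρ xs)^[i] ∅) ρ) (Fin.append xs ys)) :
    ((translation p φ).1.operator ρ xs)^[j] ∅ = (φ.operator ρ xs)^[j] ∅ := by
  induction j with
  | zero => rfl
  | succ j ihj =>
    rw [Function.iterate_succ_apply', Function.iterate_succ_apply',
      ihj fun i hi => h i (hi.trans j.lt_succ_self)]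
    exact Set.ext fun ys => ih _ ys (h j j.lt_succ_self ys)

/-- Where the second component of the translation holds, the first one is equivalent to the
original formula. -/
theorem realize_translation {p : ℕ} (hp : 0 < p) {Γ : List ℕ} {n : ℕ} (φ : PFPFormula L Γ n)
    (ρ : RelEnv M Γ) (xs : Fin n → M) (h : (translation p φ).2.Realize ρ xs) :
    (translation p φ).1.Realize ρ xs ↔ φ.Realize ρ xs := by
  induction φ with
  | falsum => rfl
  | equal t₁ t₂ => rfl
  | rel R ts => rfl
  | relVar i ts => rfl
  | imp φ ψ ihφ ihψ =>
    simp only [translation, RelFormula.realize_and] at h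
    exact imp_congr (ihφ ρ xs h.1) (ihψ ρ xs h.2)
  | all φ ih => exact forall_congr' fun a => ih ρ _ (h a)
  | @pfp Γ n k φ ts ih =>
    rw [realize_translation_pfp_snd] at h
    obtain ⟨h1, h2⟩ := h
    have hstage (j : ℕ) (hj : j ≤ 2 * p) :
        ((translation p φ).1.operator ρ xs)^[j] ∅ = (φ.operator ρ xs)^[j] ∅ := by
      induction j with
      | zero => rfl
      | succ j ihj =>
        have hj' := ihj (by omega)
        rw [Function.iterate_succ_apply', Function.iterate_succ_apply', hj']
        refine Set.ext fun ys => ih _ _ ?_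
        rw [← hj']
        exact h2 j (by omega) ys
    have hsub : termValues (Fin.append (fun j : Fin n => (varTerm j : L.Term (Empty ⊕ Fin n))) ts)
        xs = Fin.append xs (termValues ts xs) := by
      rw [termValues_append]; rfl
    have hmem : (((translation p φ).1.stage p).subst
        (Fin.append (fun j : Fin n => varTerm j) ts)).Realize ρ xs ↔
        termValues ts xs ∈ (φ.operator ρ xs)^[p] ∅ := by
      rw [RelFormula.realize_subst, hsub, ← hstage p (by omega), ← RelFormula.setOf_realize_stage]
      rfl
    rw [hstage p (by omega), hstage (2 * p) le_rfl] at h1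
    simp only [translation, RelFormula.realize_and, RelFormula.realize_equiv,
      RelFormula.setOf_realize_stage, hmem]
    rw [hstage p (by omega), hstage (p + 1) (by omega)]
    exact (mem_partialFixedPoint_iff_of_period _ hp h1 _).symm

end Translation

/-! ### Invariance under equality of types -/

section Invariance

variable {L : FirstOrder.Language.{u, v}} {M : Type w} [L.Structure M]

/-- The interpretations `ρ` and `ρ'` agree on tuples that have the same type over the parameters
`xs` and `ys` respectively. -/
def SameRel (L : FirstOrder.Language.{u, v}) {M : Type w} [L.Structure M] {Γ : List ℕ} {n : ℕ}
    (ρ : RelEnv M Γ) (xs : Fin n → M) (ρ' : RelEnv M Γ) (ys : Fin n → M) : Prop :=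
  ∀ (i : Fin Γ.length) (as bs : Fin (Γ.get i) → M),
    SameType L (Fin.append xs as) (Fin.append ys bs) → (as ∈ ρ i ↔ bs ∈ ρ' i)

/-- Types of tuples extend back and forth by several entries at once. -/
theorem SameType.exists_append (hM : ∀ n, Finite (Quotient (typeSetoid L M n))) {n k : ℕ}
    {xs ys : Fin n → M} (h : SameType L xs ys) (as : Fin k → M) :
    ∃ bs : Fin k → M, SameType L (Fin.append xs as) (Fin.append ys bs) := by
  induction k with
  | zero => exact ⟨as, by
      rw [Subsingleton.elim as Fin.elim0, Fin.append_elim0, Fin.append_elim0]; exact h⟩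
  | succ k ih =>
    obtain ⟨bs, hbs⟩ := ih (Fin.init as)
    obtain ⟨b, hb⟩ := hbs.exists_snoc (as (Fin.last k))
    refine ⟨Fin.snoc bs b, ?_⟩
    rw [← Fin.snoc_init_self as, Fin.append_snoc, Fin.append_snoc]
    exact hb

theorem SameType.append_termValues {n k : ℕ} {xs ys : Fin n → M} (h : SameType L xs ys)
    (ts : Fin k → L.Term (Empty ⊕ Fin n)) :
    SameType L (Fin.append xs (termValues ts xs)) (Fin.append ys (termValues ts ys)) := by
  have := h.substitute (Fin.append (fun j : Fin n => varTerm j) ts)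
  have key (xs : Fin n → M) : (fun j => (Fin.append (fun j : Fin n => varTerm j) ts j).realize
      (Sum.elim Empty.elim xs)) = Fin.append xs (termValues ts xs) :=
    termValues_append _ _ _
  rwa [key, key] at this

theorem SameRel.append {Γ : List ℕ} {n k : ℕ} {ρ ρ' : RelEnv M Γ} {xs ys : Fin n → M}
    (h : SameRel L ρ xs ρ' ys) (as bs : Fin k → M) :
    SameRel L ρ (Fin.append xs as) ρ' (Fin.append ys bs) := by
  intro i cs ds hcd
  refine h i cs ds ?_
  have := hcd.comp (Fin.append (fun j : Fin n => (j.castAdd k).castAdd (Γ.get i))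
    (fun j : Fin (Γ.get i) => Fin.natAdd (n + k) j))
  have key (xs : Fin n → M) (as : Fin k → M) (cs : Fin (Γ.get i) → M) :
      Fin.append (Fin.append xs as) cs ∘ (Fin.append (fun j : Fin n =>
        (j.castAdd k).castAdd (Γ.get i)) (fun j : Fin (Γ.get i) => Fin.natAdd (n + k) j)) =
      Fin.append xs cs := by
    funext j
    refine Fin.addCases (fun j => ?_) (fun j => ?_) j <;> simp
  rwa [key, key] at this

theorem SameRel.snoc {Γ : List ℕ} {n : ℕ} {ρ ρ' : RelEnv M Γ} {xs ys : Fin n → M}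
    (h : SameRel L ρ xs ρ' ys) (a b : M) :
    SameRel L ρ (Fin.snoc xs a : Fin (n + 1) → M) ρ' (Fin.snoc ys b : Fin (n + 1) → M) := by
  rw [← Fin.append_right_eq_snoc xs (fun _ => a), ← Fin.append_right_eq_snoc ys (fun _ => b)]
  exact h.append _ _

theorem SameRel.cons {Γ : List ℕ} {n k : ℕ} {ρ ρ' : RelEnv M Γ} {xs ys : Fin n → M}
    (h : SameRel L ρ xs ρ' ys) {S S' : Set (Fin k → M)}
    (hS : ∀ as bs : Fin k → M, SameType L (Fin.append xs as) (Fin.append ys bs) →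
      (as ∈ S ↔ bs ∈ S')) :
    SameRel L (RelEnv.cons S ρ) xs (RelEnv.cons S' ρ') ys := by
  intro i
  refine Fin.cases ?_ (fun i => ?_) i
  · exact hS
  · exact h i

/-- If satisfaction of `φ` depends only on types, then so do the stages of the operator that `φ`
defines. -/
theorem PFPFormula.mem_iterate_operator_congr {Γ : List ℕ} {n k : ℕ}
    {φ : PFPFormula L (k :: Γ) (n + k)}
    (hφ : ∀ (ρ ρ' : RelEnv M (k :: Γ)) (xs ys : Fin (n + k) → M), SameType L xs ys →
      SameRel L ρ xs ρ' ys → (φ.Realize ρ xs ↔ φ.Realize ρ' ys))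
    {ρ ρ' : RelEnv M Γ} {xs ys : Fin n → M} (hρ : SameRel L ρ xs ρ' ys) (j : ℕ)
    (as bs : Fin k → M) (hab : SameType L (Fin.append xs as) (Fin.append ys bs)) :
    as ∈ (φ.operator ρ xs)^[j] ∅ ↔ bs ∈ (φ.operator ρ' ys)^[j] ∅ := by
  induction j generalizing as bs with
  | zero => simp
  | succ j ih =>
    rw [Function.iterate_succ_apply', Function.iterate_succ_apply']
    exact hφ _ _ _ _ hab ((hρ.cons ih).append as bs)

/-- Satisfaction of formulas with fixed-point operators depends only on types. -/
theorem PFPFormula.realize_congr (hM : ∀ n, Finite (Quotient (typeSetoid L M n))) {Γ : List ℕ}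
    {n : ℕ} (φ : PFPFormula L Γ n) (ρ ρ' : RelEnv M Γ) (xs ys : Fin n → M)
    (h : SameType L xs ys) (hρ : SameRel L ρ xs ρ' ys) :
    φ.Realize ρ xs ↔ φ.Realize ρ' ys := by
  induction φ with
  | falsum => rfl
  | equal t₁ t₂ => exact h (.equal t₁ t₂)
  | rel R ts => exact h (.rel R ts)
  | relVar i ts => exact hρ i _ _ (h.append_termValues ts)
  | imp φ ψ ihφ ihψ => exact imp_congr (ihφ _ _ _ _ h hρ) (ihψ _ _ _ _ h hρ)
  | all φ ih =>
    constructor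
    · intro hx b
      obtain ⟨a, ha⟩ := h.symm.exists_snoc b
      exact (ih _ _ _ _ ha.symm (hρ.snoc a b)).1 (hx a)
    · intro hy a
      obtain ⟨b, hb⟩ := h.exists_snoc a
      exact (ih _ _ _ _ hb (hρ.snoc a b)).2 (hy b)
  | @pfp Γ n k φ ts ih =>
    have hstage := PFPFormula.mem_iterate_operator_congr ih hρ
    have hstat (j : ℕ) : (φ.operator ρ xs)^[j + 1] ∅ = (φ.operator ρ xs)^[j] ∅ ↔
        (φ.operator ρ' ys)^[j + 1] ∅ = (φ.operator ρ' ys)^[j] ∅ := by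
      constructor
      · intro heq
        ext bs
        obtain ⟨as, has⟩ := h.symm.exists_append hM bs
        rw [← hstage _ as bs has.symm, ← hstage _ as bs has.symm, heq]
      · intro heq
        ext as
        obtain ⟨bs, hbs⟩ := h.exists_append hM as
        rw [hstage _ as bs hbs, hstage _ as bs hbs, heq]
    exact exists_congr fun j => and_congr (hstat j) (hstage j _ _ (h.append_termValues ts))

/-- For all sufficiently divisible `p` the second component of the translation holds, at all
parameters and all interpretations that are invariant over the parameters. -/
theorem exists_forall_realize_translation_snd (hM : ∀ n, Finite (Quotient (typeSetoid L M n)))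
    {Γ : List ℕ} {n : ℕ} (φ : PFPFormula L Γ n) :
    ∃ N > 0, ∀ p > 0, N ∣ p → ∀ (ρ : RelEnv M Γ) (xs : Fin n → M), SameRel L ρ xs ρ xs →
      (translation p φ).2.Realize ρ xs := by
  induction φ with
  | falsum => exact ⟨1, one_pos, fun _ _ _ _ _ _ => id⟩
  | equal t₁ t₂ => exact ⟨1, one_pos, fun _ _ _ _ _ _ => id⟩
  | rel R ts => exact ⟨1, one_pos, fun _ _ _ _ _ _ => id⟩
  | relVar i ts => exact ⟨1, one_pos, fun _ _ _ _ _ _ => id⟩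
  | imp φ ψ ihφ ihψ =>
    obtain ⟨N, hN, h⟩ := ihφ
    obtain ⟨N', hN', h'⟩ := ihψ
    refine ⟨N * N', Nat.mul_pos hN hN', fun p hp hdvd ρ xs hρ => ?_⟩
    exact (RelFormula.realize_and _ _ _ _).2 ⟨h p hp ((Nat.dvd_mul_right _ _).trans hdvd) ρ xs hρ,
      h' p hp ((Nat.dvd_mul_left _ _).trans hdvd) ρ xs hρ⟩
  | all φ ih =>
    obtain ⟨N, hN, h⟩ := ih
    exact ⟨N, hN, fun p hp hdvd ρ xs hρ a => h p hp hdvd ρ _ (hρ.snoc a a)⟩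
  | @pfp Γ n k φ ts ih =>
    obtain ⟨N, hN, h⟩ := ih
    let B := Set (Quotient (typeSetoid L M (n + k)))
    refine ⟨N * (Nat.card B).factorial, Nat.mul_pos hN (Nat.factorial_pos _),
      fun p hp hdvd ρ xs hρ => ?_⟩
    have hstage := PFPFormula.mem_iterate_operator_congr
      (PFPFormula.realize_congr hM φ) hρ
    have hinner (i : ℕ) (ys : Fin k → M) : (translation p φ).2.Realize
        (RelEnv.cons ((φ.operator ρ xs)^[i] ∅) ρ) (Fin.append xs ys) :=
      h p hp ((Nat.dvd_mul_right _ _).trans hdvd) _ _ ((hρ.cons (hstage i)).append ys ys)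
    have heq (j : ℕ) := iterate_translation_eq p φ ρ xs
      (fun S ys hC => realize_translation hp φ _ _ hC) j fun i _ => hinner i
    rw [realize_translation_pfp_snd]
    simp only [heq]
    refine ⟨?_, fun i _ ys => hinner i ys⟩
    -- a stage is determined by the set of types, over the parameters, of its elements
    refine iterate_eq_iterate_two_mul (B := B) _ (fun S => {q | ∃ ys ∈ S,
      Quotient.mk (typeSetoid L M (n + k)) (Fin.append xs ys) = q}) (fun i j hij => ?_) hp
      ((Nat.dvd_mul_left _ _).trans hdvd)
    have hsub (i j : ℕ) (hij : {q | ∃ ys ∈ (φ.operator ρ xs)^[i] ∅,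
          Quotient.mk (typeSetoid L M (n + k)) (Fin.append xs ys) = q} =
        {q | ∃ ys ∈ (φ.operator ρ xs)^[j] ∅,
          Quotient.mk (typeSetoid L M (n + k)) (Fin.append xs ys) = q}) :
        (φ.operator ρ xs)^[i] ∅ ⊆ (φ.operator ρ xs)^[j] ∅ := by
      intro ys hys
      obtain ⟨zs, hzs, hq⟩ := hij.subset ⟨ys, hys, rfl⟩
      exact (hstage j zs ys (Quotient.exact hq)).1 hzs
    exact (hsub i j hij).antisymm (hsub j i hij.symm)

end Invariance

/-! ### First-order equivalents -/

section Elimination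

variable {L : FirstOrder.Language.{u, v}} {M : Type w} [L.Structure M]

/-- The sentence stating that the translation of `φ` with period `p` is correct. -/
def correctness (p : ℕ) {n : ℕ} (φ : PFPFormula L [] n) : L.Sentence :=
  (translation p φ).2.toBoundedFormula.alls

/-- If the correctness sentence is true, then the translation is a first-order equivalent. -/
theorem realize_of_correctness {p : ℕ} (hp : 0 < p) {n : ℕ} (φ : PFPFormula L [] n)
    (h : M ⊨ correctness p φ) (xs : Fin n → M) :
    (translation p φ).1.toBoundedFormula.Realize Empty.elim xs ↔ φ.Realize RelEnv.nil xs := by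
  rw [RelFormula.realize_toBoundedFormula]
  refine realize_translation hp φ _ xs ?_
  rw [← RelFormula.realize_toBoundedFormula]
  rw [Subsingleton.elim (Empty.elim : Empty → M) default]
  exact BoundedFormula.realize_alls.1 h xs

theorem exists_correctness (hM : ∀ n, Finite (Quotient (typeSetoid L M n))) {n : ℕ}
    (φ : PFPFormula L [] n) : ∃ i, M ⊨ correctness (i + 1) φ := by
  obtain ⟨N, hN, h⟩ := exists_forall_realize_translation_snd hM φ
  refine ⟨N - 1, ?_⟩
  rw [Nat.sub_add_cancel hN]
  refine BoundedFormula.realize_alls.2 fun xs => ?_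
  rw [Subsingleton.elim (default : Empty → M) Empty.elim, RelFormula.realize_toBoundedFormula]
  exact h N hN dvd_rfl _ _ fun i => i.elim0

end Elimination

/-! ### Recursion on codes -/

section Recursion

/-- Recursion along a primitive recursive tree is primitive recursive: there is a primitive
recursive `F` whose value at a node `b` is computed by `G` from the values at the children of `b`,
provided that some measure decreases from each node to its children. -/
theorem exists_primrec_recursion {α β σ : Type*} [Primcodable α] [Primcodable β] [Primcodable σ]
    {m : β → ℕ} {children : β → List β} {G : α → β × List σ → σ} (hm : Primrec m)
    (hchildren : Primrec children) (hG : Primrec₂ G) (hlt : ∀ b, ∀ b' ∈ children b, m b' < m b) :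
    ∃ F : α → β → σ, Primrec₂ F ∧ ∀ a b, F a b = G a (b, (children b).map (F a)) := by
  let F : α → β → σ := fun a => (measure m).wf.fix fun b ih =>
    G a (b, (children b).attach.map fun x : {x // x ∈ children b} => ih x.1 (hlt b x x.2))
  have hF (a : α) (b : β) : F a b = G a (b, (children b).map (F a)) := by
    change (measure m).wf.fix _ b = _
    rw [WellFounded.fix_eq]
    congr 2
    exact List.attach_map_val (l := children b) (f := F a)
  refine ⟨F, ?_, hF⟩
  refine Primrec.nat_omega_rec F (m := fun _ => m) (l := fun _ => children)
    (g := fun a x => some (G a x)) (hm.comp₂ .right) (hchildren.comp₂ .right)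
    (Primrec.option_some.comp₂ hG) (fun _ => hlt) fun a b => by rw [hF a b]

/-- The tag of a code. -/
def tag (c : ℕ) : ℕ := c.unpair.1

/-- The content of a code. -/
def content (c : ℕ) : ℕ := c.unpair.2

theorem primrec_tag : Primrec tag := Primrec.fst.comp Primrec.unpair

theorem primrec_content : Primrec content := Primrec.snd.comp Primrec.unpair

@[simp] theorem tag_pair (a b : ℕ) : tag (Nat.pair a b) = a := by simp [tag]

@[simp] theorem content_pair (a b : ℕ) : content (Nat.pair a b) = b := by simp [content]

theorem tag_le (c : ℕ) : tag c ≤ c := Nat.unpair_left_le c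

theorem content_le (c : ℕ) : content c ≤ c := Nat.unpair_right_le c

theorem content_lt {c : ℕ} (h : tag c ≠ 0) : content c < c := by
  obtain ⟨a, b, rfl⟩ : ∃ a b, c = Nat.pair a b := ⟨_, _, (Nat.pair_unpair c).symm⟩
  simp only [tag_pair, content_pair] at h ⊢
  rw [Nat.pair]
  split_ifs
  · nlinarith [Nat.pos_of_ne_zero h]
  · have := Nat.pos_of_ne_zero h
    have := Nat.mul_pos this this
    omega

theorem mem_lt_encode {l : List ℕ} {a : ℕ} (h : a ∈ l) : a < Encodable.encode l := by
  induction l with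
  | nil => simp at h
  | cons b l ih =>
    rw [Encodable.encode_list_cons]
    rcases List.mem_cons.1 h with rfl | h
    · exact Nat.lt_succ_of_le (Nat.left_le_pair _ _)
    · exact (ih h).trans_le ((Nat.right_le_pair _ _).trans (Nat.le_succ _))

/-- The list with a given code. -/
def listOf (c : ℕ) : List ℕ := Denumerable.ofNat (List ℕ) c

theorem primrec_listOf : Primrec listOf := Primrec.ofNat _

@[simp] theorem listOf_encode (l : List ℕ) : listOf (Encodable.encode l) = l :=
  Denumerable.ofNat_encode l

theorem mem_listOf_lt {a c : ℕ} (h : a ∈ listOf c) : a < c := by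
  have := mem_lt_encode h
  rwa [listOf, Denumerable.encode_ofNat] at this

theorem primrec_ite_tag {α σ : Type*} [Primcodable α] [Primcodable σ] {c : α → ℕ} (k : ℕ)
    {f g : α → σ} (hc : Primrec c) (hf : Primrec f) (hg : Primrec g) :
    Primrec fun a => if tag (c a) = k then f a else g a :=
  Primrec.ite (Primrec.eq.comp (primrec_tag.comp hc) (Primrec.const k)) hf hg

theorem primrec_pair {α : Type*} [Primcodable α] {f g : α → ℕ} (hf : Primrec f) (hg : Primrec g) :
    Primrec fun a => Nat.pair (f a) (g a) :=
  Primrec₂.natPair.comp hf hg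

end Recursion

/-! ### Substitution in codes of terms -/

section TermCodes

variable {L : FirstOrder.Language.{u, v}} [Encodable (Σ l, L.Functions l)]

/-- The code of the term substituted for the variable `i` under the substitution that is described
by a list of term codes and a number `m`: the first variables are sent to the entries of the list,
and the variables after them to `xₘ, xₘ₊₁, …`. -/
def substVar (s : List ℕ × ℕ) (i : ℕ) : ℕ :=
  (s.1[i]?).getD (Nat.pair 0 (s.2 + (i - s.1.length)))

theorem primrec_substVar : Primrec₂ substVar := by
  refine Primrec.option_getD.comp (Primrec.list_getElem?.comp (Primrec.fst.comp Primrec.fst)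
    Primrec.snd) (primrec_pair (Primrec.const 0) (Primrec.nat_add.comp
      (Primrec.snd.comp Primrec.fst) (Primrec.nat_sub.comp Primrec.snd
        (Primrec.list_length.comp (Primrec.fst.comp Primrec.fst)))))

/-- The list and the number `s` describe the substitution `σ`. -/
def Describes (s : List ℕ × ℕ) {n m : ℕ} (σ : Fin n → L.Term (Empty ⊕ Fin m)) : Prop :=
  (∀ i : Fin n, termCode (σ i) = substVar s i) ∧ s.1.length ≤ n ∧ m = s.2 + (n - s.1.length)

theorem termCode_relabel {n m : ℕ} (t : L.Term (Empty ⊕ Fin n)) (g : Fin n → Fin m)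
    (hg : ∀ i, (g i : ℕ) = i) : termCode (t.relabel (Sum.map id g)) = termCode t := by
  induction t with
  | var x =>
    rcases x with x | x
    · exact x.elim
    · simp [termCode, hg]
  | func f ts ih => simp [termCode, ih]

/-- The same description serves below a quantifier: a bound variable is named by the number of
variables in scope, and `substVar` shifts all variables beyond the list by the same amount. -/
theorem Describes.lift {s : List ℕ × ℕ} {n m : ℕ} {σ : Fin n → L.Term (Empty ⊕ Fin m)}
    (h : Describes s σ) : Describes s (liftSubst σ) := by
  obtain ⟨h1, h2, h3⟩ := h
  refine ⟨fun i => ?_, by omega, by omega⟩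
  refine Fin.lastCases ?_ (fun i => ?_) i
  · simp [liftSubst, termCode, substVar, h2, h3]
  · simp only [liftSubst, Fin.snoc_castSucc]
    rw [termCode_relabel _ Fin.castSucc fun _ => rfl, h1]
    rfl

/-- The codes of the variables `x₀, …, xₙ₋₁`. -/
def varCodes (n : ℕ) : List ℕ := (List.range n).map fun i => Nat.pair 0 i

theorem primrec_varCodes : Primrec varCodes :=
  Primrec.list_map Primrec.list_range (primrec_pair (Primrec.const 0) Primrec.snd)

theorem describes_append {n m k : ℕ} (h : n ≤ m) (ts : Fin k → L.Term (Empty ⊕ Fin m)) :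
    Describes (varCodes n ++ List.ofFn fun i => termCode (ts i), m)
      (Fin.append (fun j : Fin n => varTerm (j.castLE h)) ts) := by
  refine ⟨fun i => ?_, by simp [varCodes], by simp [varCodes]⟩
  refine Fin.addCases (fun i => ?_) (fun i => ?_) i
  · simp [substVar, varCodes, termCode, List.getElem?_append]
  · simp [substVar, varCodes]

variable (L) in
/-- Substitution in terms is primitive recursive on codes. -/
theorem exists_primrec_substTerm : ∃ F : List ℕ × ℕ → ℕ → ℕ, Primrec₂ F ∧
    ∀ {n m : ℕ} (s : List ℕ × ℕ) (t : L.Term (Empty ⊕ Fin n)) (σ : Fin n → L.Term (Empty ⊕ Fin m)),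
      Describes s σ → F s (termCode t) = termCode (substTerm t σ) := by
  let children : ℕ → List ℕ := fun c =>
    if tag c = 1 then listOf (content (content c)) else []
  let G : List ℕ × ℕ → ℕ × List ℕ → ℕ := fun s x =>
    if tag x.1 = 1 then Nat.pair 1 (Nat.pair (tag (content x.1)) (Encodable.encode x.2))
    else substVar s (content x.1)
  have hchildren : Primrec children := primrec_ite_tag 1 Primrec.id
    (primrec_listOf.comp (primrec_content.comp primrec_content)) (Primrec.const [])
  have hG : Primrec₂ G := by
    have hx : Primrec fun a : (List ℕ × ℕ) × (ℕ × List ℕ) => a.2.1 := Primrec.fst.comp Primrec.snd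
    refine primrec_ite_tag 1 hx (primrec_pair (Primrec.const 1) (primrec_pair
      (primrec_tag.comp (primrec_content.comp hx))
      (Primrec.encode.comp (Primrec.snd.comp Primrec.snd))))
      (primrec_substVar.comp Primrec.fst (primrec_content.comp hx))
  obtain ⟨F, hF, hrec⟩ := exists_primrec_recursion (m := id) Primrec.id hchildren hG
    fun b b' hb' => by
      simp only [children] at hb'
      split_ifs at hb' with h
      · exact (mem_listOf_lt hb').trans_le ((content_le _).trans (content_le _))
      · simp at hb'
  refine ⟨F, hF, fun s t σ h => ?_⟩
  induction t with
  | var x =>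
    rcases x with x | x
    · exact x.elim
    · rw [hrec]
      simp [G, termCode, substTerm, h.1]
  | func f ts ih =>
    rw [hrec]
    simp only [G, children, termCode, substTerm, Term.subst, tag_pair, content_pair, if_true,
      listOf_encode, List.map_ofFn]
    congr 4
    funext i
    exact ih i

end TermCodes

/-! ### Codes of formulas -/

section FormulaRecursion

/-- The immediate subformulas of the formula with `b.1` free element variables and code `b.2`, in
the same form. The tags `3`, `4` and `6` are those of `imp`, `all` and `pfp`; the formulas with the
other tags `0`, `1`, `2` and `5` are atomic. -/
def subformulas (b : ℕ × ℕ) : List (ℕ × ℕ) :=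
  if tag b.2 = 3 then [(b.1, tag (content b.2)), (b.1, content (content b.2))]
  else if tag b.2 = 4 then [(b.1 + 1, content b.2)]
  else if tag b.2 = 6 then [(b.1 + tag (content b.2), tag (content (content b.2)))]
  else []

theorem primrec_subformulas : Primrec subformulas := by
  have hn : Primrec fun b : ℕ × ℕ => b.1 := Primrec.fst
  have hc : Primrec fun b : ℕ × ℕ => b.2 := Primrec.snd
  have hr : Primrec fun b : ℕ × ℕ => content b.2 := primrec_content.comp hc
  have hone {f : ℕ × ℕ → ℕ × ℕ} (hf : Primrec f) : Primrec fun b => [f b] :=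
    Primrec.list_cons.comp hf (Primrec.const [])
  exact primrec_ite_tag 3 hc
    (Primrec.list_cons.comp (hn.pair (primrec_tag.comp hr))
      (hone (hn.pair (primrec_content.comp hr))))
    (primrec_ite_tag 4 hc (hone ((Primrec.succ.comp hn).pair hr))
    (primrec_ite_tag 6 hc (hone ((Primrec.nat_add.comp hn (primrec_tag.comp hr)).pair
      (primrec_tag.comp (primrec_content.comp hr)))) (Primrec.const [])))

theorem subformulas_lt (b : ℕ × ℕ) : ∀ b' ∈ subformulas b, b'.2 < b.2 := by
  intro b' hb'
  have h1 := tag_le (content b.2)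
  have h2 := content_le (content b.2)
  have h3 := tag_le (content (content b.2))
  rw [subformulas] at hb'
  split_ifs at hb' with h h h
  · have := content_lt (c := b.2) (by omega)
    simp only [List.mem_cons, List.not_mem_nil, or_false] at hb'
    rcases hb' with rfl | rfl <;> simp only <;> omega
  · have := content_lt (c := b.2) (by omega)
    simp only [List.mem_cons, List.not_mem_nil, or_false] at hb'
    subst hb'
    exact this
  · have := content_lt (c := b.2) (by omega)
    simp only [List.mem_cons, List.not_mem_nil, or_false] at hb'
    subst hb'
    simp only
    omega
  · simp at hb'

/-- Recursion on the codes of formulas is primitive recursive. -/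
theorem exists_primrec_formulaRecursion {α σ : Type*} [Primcodable α] [Primcodable σ]
    {G : α → (ℕ × ℕ) × List σ → σ} (hG : Primrec₂ G) :
    ∃ F : α → ℕ × ℕ → σ, Primrec₂ F ∧ ∀ a b, F a b = G a (b, (subformulas b).map (F a)) :=
  exists_primrec_recursion Primrec.snd primrec_subformulas hG subformulas_lt

/-- The code of an implication. -/
def impCode (a b : ℕ) : ℕ := Nat.pair 3 (Nat.pair a b)

/-- The code of a universally quantified formula. -/
def allCode (a : ℕ) : ℕ := Nat.pair 4 a

/-- The code of the contradiction. -/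
def falsumCode : ℕ := Nat.pair 0 0

/-- The code of the standard tautology. -/
def verumCode : ℕ := impCode falsumCode falsumCode

/-- The code of a conjunction. -/
def andCode (a b : ℕ) : ℕ := impCode (impCode a (impCode b falsumCode)) falsumCode

/-- The code of a formula with `k` universal quantifiers in front. -/
def allsCode (k a : ℕ) : ℕ := allCode^[k] a

/-- The code of the equivalence of two formulas for all values of `k` variables. -/
def equivCode (k a b : ℕ) : ℕ := allsCode k (andCode (impCode a b) (impCode b a))

variable {α : Type*} [Primcodable α] {f g h : α → ℕ}

theorem primrec_impCode (hf : Primrec f) (hg : Primrec g) :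
    Primrec fun a => impCode (f a) (g a) :=
  primrec_pair (Primrec.const 3) (primrec_pair hf hg)

theorem primrec_allCode (hf : Primrec f) : Primrec fun a => allCode (f a) :=
  primrec_pair (Primrec.const 4) hf

theorem primrec_andCode (hf : Primrec f) (hg : Primrec g) :
    Primrec fun a => andCode (f a) (g a) :=
  primrec_impCode (primrec_impCode hf (primrec_impCode hg (Primrec.const _))) (Primrec.const _)

theorem primrec_allsCode (hf : Primrec f) (hg : Primrec g) :
    Primrec fun a => allsCode (f a) (g a) :=
  Primrec.nat_iterate hf hg (primrec_allCode Primrec.snd)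

theorem primrec_equivCode (hh : Primrec h) (hf : Primrec f) (hg : Primrec g) :
    Primrec fun a => equivCode (h a) (f a) (g a) :=
  primrec_allsCode hh (primrec_andCode (primrec_impCode hf hg) (primrec_impCode hg hf))

end FormulaRecursion

/-! ### Codes of formulas with relation variables -/

namespace RelFormula

variable {L : FirstOrder.Language.{u, v}} [Encodable (Σ l, L.Functions l)]
  [Encodable (Σ l, L.Relations l)] {Γ : List ℕ}

/-- Gödel numbers of formulas with relation variables, consistent with `pfpCode` and `foCode`. -/
def code : {n : ℕ} → RelFormula L Γ n → ℕ
  | _, .falsum => Nat.pair 0 0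
  | _, .equal t₁ t₂ => Nat.pair 1 (Nat.pair (termCode t₁) (termCode t₂))
  | _, .rel (l := l) R ts =>
      Nat.pair 2 (Nat.pair (Encodable.encode (⟨l, R⟩ : Σ l, L.Relations l)) (termsCode ts))
  | _, .imp φ ψ => impCode φ.code ψ.code
  | _, .all φ => allCode φ.code
  | _, .relVar i ts => Nat.pair 5 (Nat.pair i (termsCode ts))

theorem code_and {n : ℕ} (φ ψ : RelFormula L Γ n) : (φ.and ψ).code = andCode φ.code ψ.code := rfl

theorem code_alls {n k : ℕ} (φ : RelFormula L Γ (n + k)) :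
    (φ.alls k).code = allsCode k φ.code := by
  induction k with
  | zero => rfl
  | succ k ih => exact (ih φ.all).trans rfl

theorem code_equiv {n k : ℕ} (φ ψ : RelFormula L Γ (n + k)) :
    (equiv k φ ψ).code = equivCode k φ.code ψ.code := by
  rw [equiv, code_alls]
  rfl

theorem foCode_toBoundedFormula {n : ℕ} (φ : RelFormula L [] n) :
    foCode φ.toBoundedFormula = φ.code := by
  induction φ with
  | falsum => rfl
  | equal t₁ t₂ => rfl
  | rel R ts => rfl
  | relVar i ts => exact i.elim0
  | imp φ ψ ihφ ihψ => simp only [toBoundedFormula, foCode, code, ihφ, ihψ, impCode]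
  | all φ ih => simp only [toBoundedFormula, foCode, code, ih, allCode]

variable (L) in
/-- Substitution of terms in formulas is primitive recursive on codes. -/
theorem exists_primrec_subst : ∃ F : List ℕ × ℕ → ℕ → ℕ, Primrec₂ F ∧
    ∀ {Γ : List ℕ} {n m : ℕ} (s : List ℕ × ℕ) (φ : RelFormula L Γ n)
      (σ : Fin n → L.Term (Empty ⊕ Fin m)), Describes s σ → F s φ.code = (φ.subst σ).code := by
  obtain ⟨S, hS, hSeq⟩ := exists_primrec_substTerm L
  let SL : List ℕ × ℕ → ℕ → ℕ := fun s c => Encodable.encode ((listOf c).map (S s))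
  have hSL : Primrec₂ SL := Primrec.encode.comp (Primrec.list_map
    (primrec_listOf.comp Primrec.snd) (hS.comp (Primrec.fst.comp Primrec.fst) Primrec.snd))
  have hSLeq {n m l : ℕ} (s : List ℕ × ℕ) (ts : Fin l → L.Term (Empty ⊕ Fin n))
      (σ : Fin n → L.Term (Empty ⊕ Fin m)) (h : Describes s σ) :
      SL s (termsCode ts) = termsCode fun i => substTerm (ts i) σ := by
    simp only [SL, termsCode, listOf_encode, List.map_ofFn]
    congr 2
    funext i
    exact hSeq s (ts i) σ h
  let G : List ℕ × ℕ → (ℕ × ℕ) × List ℕ → ℕ := fun s x =>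
    if tag x.1.2 = 0 then x.1.2
    else if tag x.1.2 = 1 then Nat.pair 1 (Nat.pair (S s (tag (content x.1.2)))
      (S s (content (content x.1.2))))
    else if tag x.1.2 = 3 then impCode (x.2.getD 0 0) (x.2.getD 1 0)
    else if tag x.1.2 = 4 then allCode (x.2.getD 0 0)
    else Nat.pair (tag x.1.2) (Nat.pair (tag (content x.1.2)) (SL s (content (content x.1.2))))
  have hG : Primrec₂ G := by
    have hs : Primrec fun a : (List ℕ × ℕ) × ((ℕ × ℕ) × List ℕ) => a.1 := Primrec.fst
    have hc : Primrec fun a : (List ℕ × ℕ) × ((ℕ × ℕ) × List ℕ) => a.2.1.2 :=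
      Primrec.snd.comp (Primrec.fst.comp Primrec.snd)
    have hl : Primrec fun a : (List ℕ × ℕ) × ((ℕ × ℕ) × List ℕ) => a.2.2 :=
      Primrec.snd.comp Primrec.snd
    have hr := primrec_content.comp hc
    have hget (i : ℕ) := (Primrec.list_getD 0).comp hl (Primrec.const i)
    refine primrec_ite_tag 0 hc hc (primrec_ite_tag 1 hc ?_ (primrec_ite_tag 3 hc
      (primrec_impCode (hget 0) (hget 1)) (primrec_ite_tag 4 hc (primrec_allCode (hget 0)) ?_)))
    · exact primrec_pair (Primrec.const 1) (primrec_pair (hS.comp hs (primrec_tag.comp hr))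
        (hS.comp hs (primrec_content.comp hr)))
    · exact primrec_pair (primrec_tag.comp hc) (primrec_pair (primrec_tag.comp hr)
        (hSL.comp hs (primrec_content.comp hr)))
  obtain ⟨F, hF, hrec⟩ := exists_primrec_formulaRecursion hG
  have key {Γ : List ℕ} {n : ℕ} (φ : RelFormula L Γ n) : ∀ {m : ℕ} (d : ℕ) (s : List ℕ × ℕ)
      (σ : Fin n → L.Term (Empty ⊕ Fin m)), Describes s σ →
        F s (d, φ.code) = (φ.subst σ).code := by
    induction φ with
    | falsum => intro m d s σ h; rw [hrec]; simp [G, code, subst]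
    | equal t₁ t₂ =>
      intro m d s σ h
      rw [hrec]
      simp [G, code, subst, hSeq _ _ _ h]
    | rel R ts =>
      intro m d s σ h
      rw [hrec]
      simp [G, code, subst, hSLeq _ _ _ h]
    | relVar i ts =>
      intro m d s σ h
      rw [hrec]
      simp [G, code, subst, hSLeq _ _ _ h]
    | imp φ ψ ihφ ihψ =>
      intro m d s σ h
      rw [hrec]
      simp [G, code, subst, subformulas, impCode, ihφ d s σ h, ihψ d s σ h]
    | all φ ih =>
      intro m d s σ h
      rw [hrec]
      simp [G, code, subst, subformulas, allCode, ih (d + 1) s _ h.lift]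
  exact ⟨fun s c => F s (0, c), hF.comp Primrec.fst ((Primrec.const 0).pair Primrec.snd),
    fun s φ σ h => key φ 0 s σ h⟩

variable (L) in
/-- Substitution for a relation variable is primitive recursive on codes. -/
theorem exists_primrec_instantiate : ∃ F : ℕ × ℕ → ℕ × ℕ → ℕ, Primrec₂ F ∧
    ∀ {Γ : List ℕ} {k n m : ℕ} (ψ : RelFormula L Γ (n + k)) (φ : RelFormula L (k :: Γ) m)
      (h : n ≤ m), F (n, ψ.code) (m, φ.code) = (instantiate ψ φ h).code := by
  obtain ⟨S, hS, hSeq⟩ := exists_primrec_subst L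
  let G : ℕ × ℕ → (ℕ × ℕ) × List ℕ → ℕ := fun p x =>
    if tag x.1.2 = 3 then impCode (x.2.getD 0 0) (x.2.getD 1 0)
    else if tag x.1.2 = 4 then allCode (x.2.getD 0 0)
    else if tag x.1.2 = 5 then
      if tag (content x.1.2) = 0 then
        S (varCodes p.1 ++ listOf (content (content x.1.2)), x.1.1) p.2
      else Nat.pair 5 (Nat.pair (tag (content x.1.2) - 1) (content (content x.1.2)))
    else x.1.2
  have hG : Primrec₂ G := by
    have hp : Primrec fun a : (ℕ × ℕ) × ((ℕ × ℕ) × List ℕ) => a.1 := Primrec.fst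
    have hm : Primrec fun a : (ℕ × ℕ) × ((ℕ × ℕ) × List ℕ) => a.2.1.1 :=
      Primrec.fst.comp (Primrec.fst.comp Primrec.snd)
    have hc : Primrec fun a : (ℕ × ℕ) × ((ℕ × ℕ) × List ℕ) => a.2.1.2 :=
      Primrec.snd.comp (Primrec.fst.comp Primrec.snd)
    have hl : Primrec fun a : (ℕ × ℕ) × ((ℕ × ℕ) × List ℕ) => a.2.2 :=
      Primrec.snd.comp Primrec.snd
    have hr := primrec_content.comp hc
    have hget (i : ℕ) := (Primrec.list_getD 0).comp hl (Primrec.const i)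
    refine primrec_ite_tag 3 hc (primrec_impCode (hget 0) (hget 1)) (primrec_ite_tag 4 hc
      (primrec_allCode (hget 0)) (primrec_ite_tag 5 hc (primrec_ite_tag 0 hr ?_ ?_) hc))
    · exact hS.comp (Primrec.pair (Primrec.list_append.comp (primrec_varCodes.comp
        (Primrec.fst.comp hp)) (primrec_listOf.comp (primrec_content.comp hr))) hm)
        (Primrec.snd.comp hp)
    · exact primrec_pair (Primrec.const 5) (primrec_pair (Primrec.pred.comp
        (primrec_tag.comp hr)) (primrec_content.comp hr))
  obtain ⟨F, hF, hrec⟩ := exists_primrec_formulaRecursion hG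
  refine ⟨F, hF, fun {Γ k n m} ψ φ h => ?_⟩
  induction φ with
  | falsum => rw [hrec]; simp [G, code, instantiate]
  | equal t₁ t₂ => rw [hrec]; simp [G, code, instantiate]
  | rel R ts => rw [hrec]; simp [G, code, instantiate]
  | relVar i ts =>
    rw [hrec]
    obtain ⟨i, hi⟩ := i
    cases i with
    | zero =>
      have := hSeq _ ψ _ (describes_append h ts)
      simpa [G, code, instantiate, instantiateAtom, termsCode] using this
    | succ i => simp [G, code, instantiate, instantiateAtom]
  | imp φ φ' ihφ ihφ' =>
    rw [hrec]
    simp [G, code, instantiate, subformulas, impCode, ihφ h, ihφ' h]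
  | all φ ih =>
    rw [hrec]
    simp [G, code, instantiate, subformulas, allCode, ih (Nat.le_succ_of_le h)]

end RelFormula

/-! ### The translation on codes -/

section TranslationCodes

variable {L : FirstOrder.Language.{u, v}} [Encodable (Σ l, L.Functions l)]
  [Encodable (Σ l, L.Relations l)]

variable (L) in
/-- The translation is primitive recursive on codes, uniformly in the period. -/
theorem exists_primrec_translation : ∃ F : ℕ → ℕ × ℕ → ℕ × ℕ, Primrec₂ F ∧
    ∀ {Γ : List ℕ} {n : ℕ} (p : ℕ) (φ : PFPFormula L Γ n),
      F p (n, pfpCode φ) = ((translation p φ).1.code, (translation p φ).2.code) := by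
  obtain ⟨S, hS, hSeq⟩ := RelFormula.exists_primrec_subst L
  obtain ⟨I, hI, hIeq⟩ := RelFormula.exists_primrec_instantiate L
  -- stages and conjunctions for given `((n, k), (u, c))`, where `u` and `c` are the codes of the
  -- two components of the translation of the formula that defines the operator
  let st : (ℕ × ℕ) × (ℕ × ℕ) → ℕ → ℕ := fun q j =>
    Nat.rec falsumCode (fun _ ψ => I (q.1.1, ψ) (q.1.1 + q.1.2, q.2.1)) j
  let cj : (ℕ × ℕ) × (ℕ × ℕ) → ℕ → ℕ := fun q j =>
    Nat.rec verumCode (fun i r => andCode r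
      (allsCode q.1.2 (I (q.1.1, st q i) (q.1.1 + q.1.2, q.2.2)))) j
  let pfpU : ℕ → ℕ → (ℕ × ℕ) × (ℕ × ℕ) → ℕ := fun p ts q =>
    andCode (equivCode q.1.2 (st q p) (st q (p + 1)))
      (S (varCodes q.1.1 ++ listOf ts, q.1.1) (st q p))
  let pfpC : ℕ → (ℕ × ℕ) × (ℕ × ℕ) → ℕ := fun p q =>
    andCode (equivCode q.1.2 (st q p) (st q (2 * p))) (cj q (2 * p))
  let G : ℕ → (ℕ × ℕ) × List (ℕ × ℕ) → ℕ × ℕ := fun p x =>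
    if tag x.1.2 = 3 then (impCode (x.2.getD 0 0).1 (x.2.getD 1 0).1,
      andCode (x.2.getD 0 0).2 (x.2.getD 1 0).2)
    else if tag x.1.2 = 4 then (allCode (x.2.getD 0 0).1, allCode (x.2.getD 0 0).2)
    else if tag x.1.2 = 6 then
      (pfpU p (content (content (content x.1.2)))
        ((x.1.1, tag (content x.1.2)), x.2.getD 0 0),
      pfpC p ((x.1.1, tag (content x.1.2)), x.2.getD 0 0))
    else (x.1.2, verumCode)
  have hst : Primrec₂ st := by
    refine Primrec.nat_rec (Primrec.const falsumCode)
      (g := fun (q : (ℕ × ℕ) × (ℕ × ℕ)) (x : ℕ × ℕ) => I (q.1.1, x.2) (q.1.1 + q.1.2, q.2.1)) ?_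
    have hn : Primrec fun a : ((ℕ × ℕ) × (ℕ × ℕ)) × (ℕ × ℕ) => a.1.1.1 :=
      Primrec.fst.comp (Primrec.fst.comp Primrec.fst)
    have hk : Primrec fun a : ((ℕ × ℕ) × (ℕ × ℕ)) × (ℕ × ℕ) => a.1.1.2 :=
      Primrec.snd.comp (Primrec.fst.comp Primrec.fst)
    exact hI.comp (hn.pair (Primrec.snd.comp Primrec.snd)) ((Primrec.nat_add.comp hn hk).pair
      (Primrec.fst.comp (Primrec.snd.comp Primrec.fst)))
  have hcj : Primrec₂ cj := by
    refine Primrec.nat_rec (Primrec.const verumCode)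
      (g := fun (q : (ℕ × ℕ) × (ℕ × ℕ)) (x : ℕ × ℕ) => andCode x.2
      (allsCode q.1.2 (I (q.1.1, st q x.1) (q.1.1 + q.1.2, q.2.2)))) ?_
    have hn : Primrec fun a : ((ℕ × ℕ) × (ℕ × ℕ)) × (ℕ × ℕ) => a.1.1.1 :=
      Primrec.fst.comp (Primrec.fst.comp Primrec.fst)
    have hk : Primrec fun a : ((ℕ × ℕ) × (ℕ × ℕ)) × (ℕ × ℕ) => a.1.1.2 :=
      Primrec.snd.comp (Primrec.fst.comp Primrec.fst)
    exact primrec_andCode (Primrec.snd.comp Primrec.snd) (primrec_allsCode hk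
      (hI.comp (hn.pair (hst.comp Primrec.fst (Primrec.fst.comp Primrec.snd)))
        ((Primrec.nat_add.comp hn hk).pair (Primrec.snd.comp (Primrec.snd.comp Primrec.fst)))))
  have hG : Primrec₂ G := by
    have hp : Primrec fun a : ℕ × ((ℕ × ℕ) × List (ℕ × ℕ)) => a.1 := Primrec.fst
    have hn : Primrec fun a : ℕ × ((ℕ × ℕ) × List (ℕ × ℕ)) => a.2.1.1 :=
      Primrec.fst.comp (Primrec.fst.comp Primrec.snd)
    have hc : Primrec fun a : ℕ × ((ℕ × ℕ) × List (ℕ × ℕ)) => a.2.1.2 :=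
      Primrec.snd.comp (Primrec.fst.comp Primrec.snd)
    have hl : Primrec fun a : ℕ × ((ℕ × ℕ) × List (ℕ × ℕ)) => a.2.2 :=
      Primrec.snd.comp Primrec.snd
    have hr := primrec_content.comp hc
    have hk := primrec_tag.comp hr
    have hget (i : ℕ) := (Primrec.list_getD (0 : ℕ × ℕ)).comp hl (Primrec.const i)
    have hget₁ (i : ℕ) := Primrec.fst.comp (hget i)
    have hget₂ (i : ℕ) := Primrec.snd.comp (hget i)
    have hq := (hn.pair hk).pair (hget 0)
    have hstp := hst.comp hq hp
    have h2p := Primrec.nat_mul.comp (Primrec.const 2) hp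
    refine primrec_ite_tag 3 hc
      ((primrec_impCode (hget₁ 0) (hget₁ 1)).pair (primrec_andCode (hget₂ 0) (hget₂ 1)))
      (primrec_ite_tag 4 hc ((primrec_allCode (hget₁ 0)).pair (primrec_allCode (hget₂ 0)))
      (primrec_ite_tag 6 hc (Primrec.pair ?_ ?_) (hc.pair (Primrec.const _))))
    · exact primrec_andCode (primrec_equivCode hk hstp (hst.comp hq (Primrec.succ.comp hp)))
        (hS.comp ((Primrec.list_append.comp (primrec_varCodes.comp hn) (primrec_listOf.comp
          (primrec_content.comp (primrec_content.comp hr)))).pair hn) hstp)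
    · exact primrec_andCode (primrec_equivCode hk hstp (hst.comp hq h2p)) (hcj.comp hq h2p)
  obtain ⟨F, hF, hrec⟩ := exists_primrec_formulaRecursion hG
  refine ⟨F, hF, fun {Γ n} p φ => ?_⟩
  induction φ with
  | falsum => rw [hrec]; simp [G, pfpCode, translation, RelFormula.code, verumCode, falsumCode]
  | equal t₁ t₂ => rw [hrec]; simp [G, pfpCode, translation, RelFormula.code, verumCode, falsumCode]
  | rel R ts => rw [hrec]; simp [G, pfpCode, translation, RelFormula.code, verumCode, falsumCode]
  | relVar i ts => rw [hrec]; simp [G, pfpCode, translation, RelFormula.code, verumCode, falsumCode]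
  | imp φ ψ ihφ ihψ =>
    rw [hrec]
    simp [G, pfpCode, translation, RelFormula.code, RelFormula.code_and, subformulas, ihφ, ihψ]
  | all φ ih =>
    rw [hrec]
    simp [G, pfpCode, translation, RelFormula.code, subformulas, ih]
  | @pfp Γ n k φ ts ih =>
    have hsub : (subformulas (n, pfpCode (.pfp k φ ts))).map (F p) =
        [((translation p φ).1.code, (translation p φ).2.code)] := by
      simp [subformulas, pfpCode, ih]
    have hst' (j : ℕ) : st ((n, k), ((translation p φ).1.code, (translation p φ).2.code)) j =
        ((translation p φ).1.stage j).code := by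
      induction j with
      | zero => rfl
      | succ j ihj =>
        have := hIeq ((translation p φ).1.stage j) (translation p φ).1 (Nat.le_add_right n k)
        rw [← ihj] at this
        exact this
    have hcj' (j : ℕ) : cj ((n, k), ((translation p φ).1.code, (translation p φ).2.code)) j =
        (RelFormula.conj (fun i => (RelFormula.instantiate ((translation p φ).1.stage i)
            (translation p φ).2 (Nat.le_add_right n k)).alls k) j).code := by
      induction j with
      | zero => rfl
      | succ j ihj =>
        have := hIeq ((translation p φ).1.stage j) (translation p φ).2 (Nat.le_add_right n k)
        rw [RelFormula.conj, RelFormula.code_and, RelFormula.code_alls, ← ihj, ← this, ← hst']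
    have hS' := hSeq _ ((translation p φ).1.stage p) _ (describes_append le_rfl ts)
    rw [hrec, hsub]
    simp only [G, pfpCode, tag_pair, content_pair, pfpU, pfpC, hst', hcj', termsCode, listOf_encode,
      List.getD_cons_zero, translation, RelFormula.code_and, RelFormula.code_equiv]
    rw [hS']
    rfl

end TranslationCodes

/-! ### Injectivity of the codes -/

section Injectivity

variable {L : FirstOrder.Language.{u, v}} [Encodable (Σ l, L.Functions l)]

/-- Terms over the same variables have different codes, although neither the arities nor the sets
of codes of the symbols are assumed to be computable. -/
theorem termCode_injective {n : ℕ} :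
    Function.Injective (termCode : L.Term (Empty ⊕ Fin n) → ℕ) := by
  intro t
  induction t with
  | var x =>
    intro t' h
    rcases x with x | x
    · exact x.elim
    cases t' with
    | var y =>
      rcases y with y | y
      · exact y.elim
      · simp only [termCode, Nat.pair_eq_pair, Sum.elim_inr] at h
        rw [Fin.ext h.2]
    | func f ts => simp [termCode, Nat.pair_eq_pair] at h
  | func f ts ih =>
    intro t' h
    cases t' with
    | var y => simp [termCode, Nat.pair_eq_pair] at h
    | func g ts' =>
      simp only [termCode, Nat.pair_eq_pair, true_and] at h
      have h1 := Encodable.encode_injective h.1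
      cases h1
      have h2 := List.ofFn_injective (Encodable.encode_injective h.2)
      congr 1
      funext i
      exact ih i (congrFun h2 i)

theorem termsCode_injective {n l : ℕ} :
    Function.Injective (termsCode : (Fin l → L.Term (Empty ⊕ Fin n)) → ℕ) := by
  intro ts ts' h
  have h2 := List.ofFn_injective (Encodable.encode_injective h)
  exact funext fun i => termCode_injective (congrFun h2 i)

variable [Encodable (Σ l, L.Relations l)]

/-- A number is the code of at most one sentence, so that the decision procedure for the theory,
which speaks about numbers, decides the truth of each sentence. -/
theorem foCode_injective {n : ℕ} :
    Function.Injective (foCode : L.BoundedFormula Empty n → ℕ) := by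
  intro φ
  induction φ with
  | falsum =>
    intro ψ h
    cases ψ <;> simp_all [foCode, Nat.pair_eq_pair]
  | equal t₁ t₂ =>
    intro ψ h
    cases ψ <;> simp_all [foCode, Nat.pair_eq_pair, termCode_injective.eq_iff]
  | rel R ts =>
    intro ψ h
    cases ψ with
    | rel R' ts' =>
      simp only [foCode, Nat.pair_eq_pair, true_and] at h
      have h1 := Encodable.encode_injective h.1
      cases h1
      rw [termsCode_injective h.2]
    | _ => simp [foCode, Nat.pair_eq_pair] at h
  | imp φ φ' ih ih' =>
    intro ψ h
    cases ψ with
    | imp ψ ψ' =>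
      simp only [foCode, Nat.pair_eq_pair, true_and] at h
      rw [ih h.1, ih' h.2]
    | _ => simp [foCode, Nat.pair_eq_pair] at h
  | all φ ih =>
    intro ψ h
    cases ψ with
    | all ψ =>
      simp only [foCode, Nat.pair_eq_pair, true_and] at h
      rw [ih h]
    | _ => simp [foCode, Nat.pair_eq_pair] at h

theorem foCode_alls {n : ℕ} (φ : L.BoundedFormula Empty n) :
    foCode φ.alls = allsCode n (foCode φ) := by
  induction n with
  | zero => rfl
  | succ n ih => exact (ih φ.all).trans rfl

end Injectivity

end PFP

/-! ### Effective elimination of partial fixed points -/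

theorem mainTheorem3 {L : FirstOrder.Language.{u, v}}
    [Encodable (Σ l, L.Functions l)] [Encodable (Σ l, L.Relations l)]
    (M : Type w) [L.Structure M] [Countable M] (hM : PFP.OmegaCategorical L M) :
    ∃ T : (n : ℕ) → PFP.PFPFormula L [] n → L.BoundedFormula Empty n,
      (∀ (n : ℕ) (φ : PFP.PFPFormula L [] n) (xs : Fin n → M),
        (T n φ).Realize Empty.elim xs ↔ φ.Realize PFP.RelEnv.nil xs) ∧
      (PFP.HasDecidableTheory L M →
        ∃ f : ℕ → ℕ →. ℕ, Partrec₂ f ∧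
          ∀ (n : ℕ) (φ : PFP.PFPFormula L [] n),
            f n (PFP.pfpCode φ) = Part.some (PFP.foCode (T n φ))) := by
  classical
  have : Countable L.Symbols := inferInstanceAs
    (Countable ((Σ l, L.Functions l) ⊕ Σ l, L.Relations l))
  have hex {n : ℕ} (φ : PFP.PFPFormula L [] n) :=
    PFP.exists_correctness (M := M) hM.finite_types φ
  -- the period has to be positive: for period `0` the correctness sentence holds trivially
  refine ⟨fun n φ => (PFP.translation (Nat.find (hex φ) + 1) φ).1.toBoundedFormula,
    fun n φ xs => PFP.realize_of_correctness (Nat.succ_pos _) φ (Nat.find_spec (hex φ)) xs, ?_⟩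
  intro hdec
  obtain ⟨hP, hdec⟩ := hdec
  obtain ⟨F, hF, hFeq⟩ := PFP.exists_primrec_translation L
  -- whether the correctness sentence for the period `i + 1` is true in `M`
  let test : ℕ × ℕ → ℕ → Bool := fun a i =>
    decide (∃ σ : L.Sentence, M ⊨ σ ∧ PFP.foCode σ = PFP.allsCode a.1 (F (i + 1) a).2)
  have hFa : Primrec fun b : (ℕ × ℕ) × ℕ => F (b.2 + 1) b.1 :=
    hF.comp (Primrec.succ.comp Primrec.snd) Primrec.fst
  have htest : Computable₂ test := by
    have h1 : Primrec fun b : (ℕ × ℕ) × ℕ => PFP.allsCode b.1.1 (F (b.2 + 1) b.1).2 :=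
      PFP.primrec_allsCode (Primrec.fst.comp Primrec.fst) (Primrec.snd.comp hFa)
    exact (hdec.comp h1.to_comp).of_eq fun b => by simp only [test]
  refine ⟨fun n c => (Nat.rfind fun i => Part.some (test (n, c) i)).map
    fun i => (F (i + 1) (n, c)).1, ?_, fun n φ => ?_⟩
  · exact (Partrec.rfind htest.partrec₂).map (Primrec.fst.comp hFa).to_comp.to₂
  · have htrue (i : ℕ) : test (n, PFP.pfpCode φ) i = true ↔ M ⊨ PFP.correctness (i + 1) φ := by
      have : PFP.allsCode n (F (i + 1) (n, PFP.pfpCode φ)).2 =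
          PFP.foCode (PFP.correctness (i + 1) φ) := by
        rw [hFeq, PFP.correctness, PFP.foCode_alls, PFP.RelFormula.foCode_toBoundedFormula]
      simp only [test, this, decide_eq_true_eq]
      exact ⟨fun ⟨σ, h1, h2⟩ => PFP.foCode_injective h2 ▸ h1, fun h => ⟨_, h, rfl⟩⟩
    rw [PFP.RelFormula.foCode_toBoundedFormula]
    refine Part.eq_some_iff.2 ((Part.mem_map_iff _).2 ⟨Nat.find (hex φ), ?_, by rw [hFeq]⟩)
    refine Nat.mem_rfind.2 ⟨?_, fun {i} hi => ?_⟩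
    · exact Part.mem_some_iff.2 ((htrue _).2 (Nat.find_spec (hex φ))).symm
    · have := Nat.find_min (hex φ) hi
      rw [← htrue, Bool.not_eq_true] at this
      exact Part.mem_some_iff.2 this.symm
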